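/- Let $X$ be a complex Banach space. An operator $S(X\to X)$ is a linear map from a linear subspace $\mathcal D(S)\subset X$ into $X$; its resolvent set $\varrho(S)$ consists of those $\lambda\in\mathbb C$ for which $S-\lambda:\mathcal D(S)\to X$ is bijective with bounded inverse, and $\sigma(S)=\mathbb C\setminus\varrho(S)$. A subspace $U\subset X$ is $S$-invariant if $S(\mathcal D(S)\cap U)\subset U$; then $S|U$ denotes the operator in $U$ with domain $\mathcal D(S)\cap U$ that acts as $S$. Sums of operators have domain $\mathcal D(S+R)=\mathcal D(S)\cap\mathcal D(R)$. The operator $S$ is called - *bisectorial* if $i\mathbb R\setminus\{0\}\subset\varrho(S)$ and there is $M$ with $\|(S-\lambda)^{-1}\|\le M/|\lambda|$ for all $\lambda\in i\mathbb R\setminus\{0\}$; - *almost bisectorial with exponent $\beta$*, where $0<\beta<1$, if $i\mathbb R\setminus\{0\}\subset\varrho(S)$ and there is $M$ with $\|(S-\lambda)^{-1}\|\le M/|\lambda|^{\beta}$ for all $\lambda\in i\mathbb R\setminus\{0\}$; - *strictly dichotomous* if $i\mathbb R\subset\varrho(S)$ and there are closed $S$-invariant subspaces $X_+,X_-$ with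 $X=X_+\oplus X_-$ such that $\sigma(S|X_+)\subset\{\operatorname{Re}\lambda>0\}$, $\sigma(S|X_-)\subset\{\operatorname{Re}\lambda<0\}$, $\|(S|X_+-\lambda)^{-1}\|$ is bounded on $\{\operatorname{Re}\lambda\le0\}$ and $\|(S|X_--\lambda)^{-1}\|$ is bounded on $\{\operatorname{Re}\lambda\ge0\}$. An operator $R(X\to X)$ is *$p$-subordinate* to $S$, where $0\le p\le1$, if $\mathcal D(S)\subset\mathcal D(R)$ and there is $c>0$ with $\|Rx\|\le c\|x\|^{1-p}\|Sx\|^{p}$ for all $x\in\mathcal D(S)$ (with $0^0=1$). **Corollary 7.5.** Let $S(X\to X)$ be densely defined, almost bisectorial with exponent $\beta>1/2$, and strictly dichotomous. Let $R(X\to X)$ be $p$-subordinate to $S$ with $p<2\beta-1$, and let $T=S+R$. If $i\mathbb R\subset\varrho(T)$, then $T$ is strictly dichotomous and almost bisectorial with the same exponent $\beta$. Moreover, if $S$ is bisectorial, then so is $T$. -/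

import Mathlib

/-! Unbounded operators in a complex normed space `X`, i.e. linear maps defined on a (not
necessarily dense) linear subspace, are Mathlib's `X →ₗ.[ℂ] X`; the sum `S + R` of two of them has
domain `S.domain ⊓ R.domain`. -/

noncomputable section

namespace Dichotomy

variable {X : Type*} [NormedAddCommGroup X] [NormedSpace ℂ X]

/-- `B` is a bounded, everywhere defined two-sided inverse of `S - z : D(S) → X`. -/
def IsResolventOp (S : X →ₗ.[ℂ] X) (z : ℂ) (B : X →L[ℂ] X) : Prop :=
  (∀ x : S.domain, B (S x - z • (x : X)) = x) ∧
    ∀ y : X, ∃ x : S.domain, (x : X) = B y ∧ S x - z • (x : X) = y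

/-- The resolvent set `ϱ(S)`. -/
def resolventSet (S : X →ₗ.[ℂ] X) : Set ℂ :=
  {z | ∃ B : X →L[ℂ] X, IsResolventOp S z B}

/-- The spectrum `σ(S)`. -/
def spectrum (S : X →ₗ.[ℂ] X) : Set ℂ := (resolventSet S)ᶜ

open Classical in
/-- The resolvent `(S - z)⁻¹` for `z ∈ ϱ(S)` (and `0` for `z ∈ σ(S)`). -/
def resolvent (S : X →ₗ.[ℂ] X) (z : ℂ) : X →L[ℂ] X :=
  if h : ∃ B : X →L[ℂ] X, IsResolventOp S z B then h.choose else 0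

theorem isResolventOp_unique {S : X →ₗ.[ℂ] X} {z : ℂ} {B C : X →L[ℂ] X}
    (hB : IsResolventOp S z B) (hC : IsResolventOp S z C) : B = C := by
  ext y
  obtain ⟨x, hx, hy⟩ := hC.2 y
  rw [← hx, ← hy]
  exact hB.1 x

theorem resolvent_spec {S : X →ₗ.[ℂ] X} {z : ℂ} (hz : z ∈ resolventSet S) :
    IsResolventOp S z (resolvent S z) := by
  have hz' : ∃ B : X →L[ℂ] X, IsResolventOp S z B := hz
  rw [resolvent, dif_pos hz']
  exact hz'.choose_spec

theorem resolvent_eq {S : X →ₗ.[ℂ] X} {z : ℂ} {B : X →L[ℂ] X} (hB : IsResolventOp S z B) :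
    resolvent S z = B :=
  isResolventOp_unique (resolvent_spec ⟨B, hB⟩) hB

/-- The imaginary axis `iℝ`. -/
def imaginaryAxis : Set ℂ := {z | z.re = 0}

/-- The subspace `U` is `S`-invariant: `S` maps `D(S) ∩ U` into `U`. -/
def IsInvariant (S : X →ₗ.[ℂ] X) (U : Submodule ℂ X) : Prop :=
  ∀ x : S.domain, (x : X) ∈ U → S x ∈ U

/-- The restriction `S|U` of `S` to an `S`-invariant subspace `U`, as an operator in `U` with
domain `D(S) ∩ U`. -/
def restriction (S : X →ₗ.[ℂ] X) (U : Submodule ℂ X) (hU : IsInvariant S U) : U →ₗ.[ℂ] U where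
  domain := S.domain.comap U.subtype
  toFun :=
    { toFun := fun x => ⟨S ⟨((x : U) : X), x.2⟩, hU _ (x : U).2⟩
      map_add' := fun x y => Subtype.ext
        (S.map_add ⟨((x : U) : X), x.2⟩ ⟨((y : U) : X), y.2⟩)
      map_smul' := fun c x => Subtype.ext
        (S.map_smul c ⟨((x : U) : X), x.2⟩) }

/-- `S` is dichotomous with respect to the decomposition `X = Xp ⊕ Xm` into closed subspaces. -/
structure IsDichotomousWrt (S : X →ₗ.[ℂ] X) (Xp Xm : Submodule ℂ X) : Prop where
  isClosed_pos : IsClosed (Xp : Set X)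
  isClosed_neg : IsClosed (Xm : Set X)
  isCompl : IsCompl Xp Xm
  axis_subset : imaginaryAxis ⊆ resolventSet S
  invariant_pos : IsInvariant S Xp
  invariant_neg : IsInvariant S Xm
  spectrum_pos : spectrum (restriction S Xp invariant_pos) ⊆ {z | 0 < z.re}
  spectrum_neg : spectrum (restriction S Xm invariant_neg) ⊆ {z | z.re < 0}

/-- `S` is strictly dichotomous with respect to `X = Xp ⊕ Xm`: in addition, the resolvents of the
two restrictions are bounded on the respective closed half-planes. -/
structure IsStrictlyDichotomousWrt (S : X →ₗ.[ℂ] X) (Xp Xm : Submodule ℂ X) : Prop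
    extends IsDichotomousWrt S Xp Xm where
  bounded_pos : ∃ M : ℝ, ∀ z : ℂ, z.re ≤ 0 →
    ‖resolvent (restriction S Xp invariant_pos) z‖ ≤ M
  bounded_neg : ∃ M : ℝ, ∀ z : ℂ, 0 ≤ z.re →
    ‖resolvent (restriction S Xm invariant_neg) z‖ ≤ M

/-- `S` is strictly dichotomous with respect to some decomposition of `X`. -/
def IsStrictlyDichotomous (S : X →ₗ.[ℂ] X) : Prop :=
  ∃ Xp Xm : Submodule ℂ X, IsStrictlyDichotomousWrt S Xp Xm

/-- `S` is bisectorial. -/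
def IsBisectorial (S : X →ₗ.[ℂ] X) : Prop :=
  imaginaryAxis \ {0} ⊆ resolventSet S ∧
    ∃ M : ℝ, ∀ z ∈ imaginaryAxis \ {0}, ‖resolvent S z‖ ≤ M / ‖z‖

/-- `S` is almost bisectorial with exponent `β ∈ (0, 1)`. -/
def IsAlmostBisectorial (S : X →ₗ.[ℂ] X) (β : ℝ) : Prop :=
  0 < β ∧ β < 1 ∧ imaginaryAxis \ {0} ⊆ resolventSet S ∧
    ∃ M : ℝ, ∀ z ∈ imaginaryAxis \ {0}, ‖resolvent S z‖ ≤ M / ‖z‖ ^ β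

/-- `R` is `p`-subordinate to `S`, where `0 ≤ p ≤ 1`. -/
def IsSubordinate (R S : X →ₗ.[ℂ] X) (p : ℝ) : Prop :=
  0 ≤ p ∧ p ≤ 1 ∧ ∃ h : S.domain ≤ R.domain, ∃ c : ℝ, 0 < c ∧
    ∀ x : S.domain, ‖R ⟨x, h x.2⟩‖ ≤ c * (‖(x : X)‖ ^ (1 - p) * ‖S x‖ ^ p)

end Dichotomy

end

open Complex MeasureTheory Filter Topology

namespace Dichotomy

/-! ### Resolvent identities, Neumann series and holomorphy of the resolvent. -/

section ResolventTheory

variable {X : Type*} [NormedAddCommGroup X] [NormedSpace ℂ X]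

/-! The spectral projections are read off from the resolvent on the imaginary axis. Put N_V(z) =
(1/2π) ∫ (it - z)⁻¹ (V - it)⁻¹ dt (`cauchyTransform`), which converges in operator norm as soon as
the resolvent decays like a negative power of |t|. For S strictly dichotomous with projection P onto
X₊, half-plane Cauchy formulas give N_S(z) = (S|X₊ - z)⁻¹P for Re z < 0 and N_S(z) = -(S|X₋ - z)⁻¹(1
- P) for Re z > 0. Hence N_S is bounded off the axis, and N_S(z)(S - z)y is Py on the left and Py -
y on the right (`exists_projection_cauchyTransform`).

Let T = S + R. Subordination and the second resolvent identity bound (T - it)⁻¹ - (S - it)⁻¹ by ‖(T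
- it)⁻¹‖ times O(|t|^(p-β)). Since p < β, absorption transfers decay from S to T, both for exponent
β and for exponent 1. The difference is then O(|t|^(p-2β)), which is integrable because p < 2β - 1.
With K its integral divided by 2π, N_T(z)(T - z)y = N_S(z)(S - z)y + Ky on the common domain, so Q =
P + K plays the role of P for T (`isStrictlyDichotomous_of_integrable_sub`).

It remains to see that Q is a projection (`isStrictlyDichotomous_of_cauchyTransform`). Near the axis
N_T(z) is (T - z)⁻¹Q or -(T - z)⁻¹(1 - Q), so (T - z)⁻¹Q(1 - Q) extends to a bounded entire function
tending to 0 along the axis. By Liouville it vanishes, and Q² = Q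
(`isIdempotent_of_partialResolvent`). The range and kernel of Q are the required subspaces, and N_T
supplies the bounded resolvents of the restrictions. -/

theorem resolvent_apply_sub {S : X →ₗ.[ℂ] X} {z : ℂ} (hz : z ∈ resolventSet S) (x : S.domain) :
    resolvent S z (S x - z • (x : X)) = x :=
  (resolvent_spec hz).1 x

theorem resolvent_mem_domain {S : X →ₗ.[ℂ] X} {z : ℂ} (hz : z ∈ resolventSet S) (y : X) :
    resolvent S z y ∈ S.domain := by
  obtain ⟨x, hx, -⟩ := (resolvent_spec hz).2 y
  exact hx ▸ x.2

theorem map_resolvent {S : X →ₗ.[ℂ] X} {z : ℂ} (hz : z ∈ resolventSet S) (y : X)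
    (h : resolvent S z y ∈ S.domain) :
    S ⟨resolvent S z y, h⟩ = y + z • resolvent S z y := by
  obtain ⟨x, hx, hy⟩ := (resolvent_spec hz).2 y
  have : x = ⟨resolvent S z y, h⟩ := Subtype.ext hx
  rw [← this, ← hx, ← hy]
  abel

/-- An operator with values in `D(S)` that is a right inverse of `S - z` is the resolvent, once `z`
belongs to the resolvent set. -/
theorem resolvent_eq_of_rightInverse {S : X →ₗ.[ℂ] X} {z : ℂ} (hz : z ∈ resolventSet S)
    {x : S.domain} {y : X} (h : S x - z • (x : X) = y) : resolvent S z y = x := by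
  rw [← h, resolvent_apply_sub hz]

theorem resolvent_injective {S : X →ₗ.[ℂ] X} {z : ℂ} (hz : z ∈ resolventSet S) :
    Function.Injective (resolvent S z) := by
  intro y₁ y₂ h
  obtain ⟨x₁, h₁, rfl⟩ := (resolvent_spec hz).2 y₁
  obtain ⟨x₂, h₂, rfl⟩ := (resolvent_spec hz).2 y₂
  have : x₁ = x₂ := Subtype.ext (by rw [h₁, h₂, h])
  rw [this]

/-- The first resolvent identity. -/
theorem resolvent_sub_resolvent {S : X →ₗ.[ℂ] X} {z w : ℂ} (hz : z ∈ resolventSet S)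
    (hw : w ∈ resolventSet S) :
    resolvent S z - resolvent S w = (z - w) • (resolvent S z * resolvent S w) := by
  ext y
  have h := resolvent_apply_sub hz ⟨_, resolvent_mem_domain hw y⟩
  rw [map_resolvent hw, add_sub_assoc, ← sub_smul, map_add, map_smul] at h
  simp only [sub_apply, smul_apply,
    mul_apply_eq_comp]
  change _ = resolvent S w y at h
  rwa [← neg_sub w z, neg_smul, sub_eq_iff_eq_add, neg_add_eq_sub, eq_sub_iff_add_eq]

theorem resolvent_mul_comm {S : X →ₗ.[ℂ] X} {z w : ℂ} (hz : z ∈ resolventSet S)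
    (hw : w ∈ resolventSet S) :
    resolvent S z * resolvent S w = resolvent S w * resolvent S z := by
  rcases eq_or_ne z w with rfl | hne
  · rfl
  · have h₁ := resolvent_sub_resolvent hz hw
    have h₂ := resolvent_sub_resolvent hw hz
    rw [← neg_sub (resolvent S z), h₁, ← neg_sub z w, neg_smul, neg_inj] at h₂
    exact smul_right_injective _ (sub_ne_zero.2 hne) h₂

theorem eventually_near_resolvent {S : X →ₗ.[ℂ] X} (w : ℂ) :
    ∀ᶠ z in nhds w, ‖z - w‖ * ‖resolvent S w‖ ≤ 1 / 2 := by
  have : Filter.Tendsto (fun z : ℂ => ‖z - w‖ * ‖resolvent S w‖) (nhds w) (nhds 0) := by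
    have : Continuous (fun z : ℂ => ‖z - w‖ * ‖resolvent S w‖) := by fun_prop
    simpa using this.tendsto w
  exact (this.eventually_lt_const (by norm_num : (0 : ℝ) < 1 / 2)).mono fun _ h => h.le

variable [CompleteSpace X]

/-- Neumann series: S - z = (1 - (z - w)B)(S - w) with B = (S - w)⁻¹, and the first factor is an
invertible bounded operator commuting with B. -/
theorem mem_resolventSet_of_norm_lt {S : X →ₗ.[ℂ] X} {z w : ℂ} (hw : w ∈ resolventSet S)
    (h : ‖z - w‖ * ‖resolvent S w‖ < 1) : z ∈ resolventSet S := by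
  set B := resolvent S w with hB
  have hlt : ‖(z - w) • B‖ < 1 := by rwa [norm_smul]
  let u := Units.oneSub ((z - w) • B) hlt
  have hu : (u : X →L[ℂ] X) = 1 - (z - w) • B := rfl
  have hcomm : B * (u : X →L[ℂ] X) = u * B := by
    rw [hu, mul_sub, sub_mul, mul_one, one_mul, mul_smul_comm, smul_mul_assoc]
  have hcomm' : B * (↑u⁻¹ : X →L[ℂ] X) = ↑u⁻¹ * B := by
    rw [Units.eq_inv_mul_iff_mul_eq, ← mul_assoc, ← hcomm, mul_assoc, Units.mul_inv, mul_one]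
  refine ⟨B * ↑u⁻¹, fun x => ?_, fun y => ⟨⟨_, resolvent_mem_domain hw ((↑u⁻¹ : X →L[ℂ] X) y)⟩,
    rfl, ?_⟩⟩
  · have h₁ : S x - z • (x : X) = (S x - w • (x : X)) - (z - w) • (x : X) := by
      rw [sub_smul]; abel
    have h₂ : B (S x - z • (x : X)) = (u : X →L[ℂ] X) x := by
      rw [h₁, map_sub, hB, resolvent_apply_sub hw, map_smul, hu]; rfl
    rw [hcomm', mul_apply_eq_comp, h₂, ← mul_apply_eq_comp, Units.inv_mul]
    rfl
  · rw [map_resolvent hw, add_sub_assoc, ← sub_smul]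
    have h₃ : (u : X →L[ℂ] X) ((↑u⁻¹ : X →L[ℂ] X) y) = y := by
      rw [← mul_apply_eq_comp, Units.mul_inv]; rfl
    conv_rhs => rw [← h₃, hu]
    rw [← neg_sub z w, neg_smul, ← sub_eq_add_neg]
    rfl

/-- By the first resolvent identity ‖(S - z)⁻¹‖ is at most ‖(S - w)⁻¹‖ plus half of itself, which is
absorbed. -/
theorem norm_resolvent_le_of_near {S : X →ₗ.[ℂ] X} {z w : ℂ} (hw : w ∈ resolventSet S)
    (h : ‖z - w‖ * ‖resolvent S w‖ ≤ 1 / 2) : ‖resolvent S z‖ ≤ 2 * ‖resolvent S w‖ := by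
  have hz := mem_resolventSet_of_norm_lt hw (h.trans_lt (by norm_num))
  have h₁ : resolvent S z = resolvent S w + (z - w) • (resolvent S z * resolvent S w) := by
    rw [← resolvent_sub_resolvent hz hw]; abel
  have h₂ : ‖resolvent S z‖ ≤ ‖resolvent S w‖ + ‖z - w‖ * (‖resolvent S z‖ * ‖resolvent S w‖) := by
    conv_lhs => rw [h₁]
    refine (norm_add_le _ _).trans ?_
    rw [norm_smul]
    gcongr
    exact norm_mul_le _ _
  nlinarith [norm_nonneg (resolvent S z)]

theorem continuousAt_resolvent {S : X →ₗ.[ℂ] X} {w : ℂ} (hw : w ∈ resolventSet S) :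
    ContinuousAt (resolvent S) w := by
  rw [ContinuousAt, tendsto_iff_norm_sub_tendsto_zero]
  have hlim : Filter.Tendsto (fun z : ℂ => ‖z - w‖ * (2 * ‖resolvent S w‖ * ‖resolvent S w‖))
      (nhds w) (nhds 0) := by
    have : Continuous (fun z : ℂ => ‖z - w‖ * (2 * ‖resolvent S w‖ * ‖resolvent S w‖)) := by
      fun_prop
    simpa using this.tendsto w
  refine squeeze_zero' (Filter.Eventually.of_forall fun _ => norm_nonneg _) ?_ hlim
  filter_upwards [eventually_near_resolvent (S := S) w] with z hz
  rw [resolvent_sub_resolvent (mem_resolventSet_of_norm_lt hw (hz.trans_lt (by norm_num))) hw,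
    norm_smul]
  gcongr
  refine (norm_mul_le _ _).trans ?_
  gcongr
  exact norm_resolvent_le_of_near hw hz

/-- The resolvent is holomorphic on the resolvent set. -/
theorem differentiableAt_resolvent {S : X →ₗ.[ℂ] X} {w : ℂ} (hw : w ∈ resolventSet S) :
    DifferentiableAt ℂ (resolvent S) w := by
  have : HasDerivAt (resolvent S) (resolvent S w * resolvent S w) w := by
    rw [hasDerivAt_iff_tendsto_slope]
    have hlim : Filter.Tendsto (fun z => resolvent S z * resolvent S w) (nhdsWithin w {w}ᶜ)
        (nhds (resolvent S w * resolvent S w)) :=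
      ((continuousAt_resolvent hw).tendsto.mono_left nhdsWithin_le_nhds).mul_const _
    refine hlim.congr' ?_
    filter_upwards [nhdsWithin_le_nhds (eventually_near_resolvent (S := S) w),
      self_mem_nhdsWithin] with z hz hne
    rw [slope_def_module,
      resolvent_sub_resolvent (mem_resolventSet_of_norm_lt hw (hz.trans_lt (by norm_num))) hw,
      inv_smul_smul₀ (sub_ne_zero.2 hne)]
  exact this.differentiableAt

end ResolventTheory

/-! ### Cauchy's theorem and integral formula on half-planes. -/

section HalfPlaneCauchy

variable {E : Type*} [NormedAddCommGroup E] [NormedSpace ℂ E]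

theorem one_add_abs_le_mul_norm_sub (z : ℂ) (hz : z.re ≠ 0) (t : ℝ) :
    1 + |t| ≤ ((1 + ‖z‖) / |z.re| + 1) * ‖(t : ℂ) * I - z‖ := by
  have h₁ : |z.re| ≤ ‖(t : ℂ) * I - z‖ := by
    simpa using abs_re_le_norm ((t : ℂ) * I - z)
  have h₂ : |t| ≤ ‖(t : ℂ) * I - z‖ + ‖z‖ := by
    simpa using norm_add_le ((t : ℂ) * I - z) z
  have h₃ : 0 < |z.re| := abs_pos.2 hz
  have h₄ : 1 + ‖z‖ ≤ (1 + ‖z‖) / |z.re| * ‖(t : ℂ) * I - z‖ := by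
    rw [div_mul_eq_mul_div, le_div_iff₀ h₃]
    gcongr
  linarith

theorem ofReal_mul_I_sub_ne_zero {z : ℂ} (hz : z.re ≠ 0) (t : ℝ) : (t : ℂ) * I - z ≠ 0 := by
  intro h
  apply hz
  simpa using congrArg re h

theorem norm_inv_axis_sub_le (z : ℂ) (hz : z.re ≠ 0) (t : ℝ) :
    ‖((t : ℂ) * I - z)⁻¹‖ ≤ ((1 + ‖z‖) / |z.re| + 1) * (1 + |t|)⁻¹ := by
  have h := one_add_abs_le_mul_norm_sub z hz t
  have h₁ : 0 < ‖(t : ℂ) * I - z‖ := norm_pos_iff.2 (ofReal_mul_I_sub_ne_zero hz t)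
  have h₂ : 0 < 1 + |t| := by positivity
  rw [norm_inv, ← div_eq_mul_inv, inv_le_comm₀ h₁ (by positivity), inv_div,
    div_le_iff₀ (by positivity)]
  linarith

theorem continuous_inv_axis_sub {z : ℂ} (hz : z.re ≠ 0) :
    Continuous fun t : ℝ => ((t : ℂ) * I - z)⁻¹ :=
  Continuous.inv₀ (by fun_prop) fun t => ofReal_mul_I_sub_ne_zero hz t

theorem integrable_one_add_abs_rpow {r : ℝ} (hr : 1 < r) :
    Integrable fun t : ℝ => (1 + |t|) ^ (-r) := by
  simpa using integrable_one_add_norm (E := ℝ) (μ := volume) (r := r) (by simpa using hr)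

/-- The Cauchy kernel gains one power of decay. -/
theorem integrable_inv_smul_of_decay {G : ℝ → E} (hG : Continuous G) {C r : ℝ} (hr : 0 < r)
    (hb : ∀ t, ‖G t‖ ≤ C * (1 + |t|) ^ (-r)) {z : ℂ} (hz : z.re ≠ 0) :
    Integrable fun t : ℝ => ((t : ℂ) * I - z)⁻¹ • G t := by
  refine ((integrable_one_add_abs_rpow (r := r + 1) (by linarith)).const_mul
    (((1 + ‖z‖) / |z.re| + 1) * C)).mono'
    ((continuous_inv_axis_sub hz).smul hG).aestronglyMeasurable (Eventually.of_forall fun t => ?_)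
  have h₂ : 0 < 1 + |t| := by positivity
  rw [norm_smul, neg_add, Real.rpow_add h₂, Real.rpow_neg_one]
  calc ‖((t : ℂ) * I - z)⁻¹‖ * ‖G t‖
      ≤ (((1 + ‖z‖) / |z.re| + 1) * (1 + |t|)⁻¹) * (C * (1 + |t|) ^ (-r)) :=
        mul_le_mul (norm_inv_axis_sub_le z hz t) (hb t) (norm_nonneg _) (by positivity)
    _ = _ := by ring

/-- Cauchy's theorem on the rectangle [-R, 0] × [-R, R]: the three sides off the axis have total
length 4R, while g = O(R⁻²) there. -/
theorem integral_axis_eq_zero {g : ℂ → E}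
    (hd : DifferentiableOn ℂ g {z | z.re ≤ 0}) (hi : Integrable fun t : ℝ => g (t * I))
    {C R₀ : ℝ} (hb : ∀ z : ℂ, z.re ≤ 0 → R₀ ≤ ‖z‖ → ‖g z‖ ≤ C / ‖z‖ ^ 2) :
    ∫ t : ℝ, g (t * I) = 0 := by
  have hlim := intervalIntegral_tendsto_integral hi tendsto_neg_atTop_atBot tendsto_id
  refine tendsto_nhds_unique hlim ?_
  rw [tendsto_zero_iff_norm_tendsto_zero]
  have hz : Tendsto (fun R : ℝ => 4 * C * R⁻¹) atTop (𝓝 0) := by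
    simpa using tendsto_inv_atTop_zero.const_mul (4 * C)
  refine squeeze_zero' (Eventually.of_forall fun _ => norm_nonneg _) ?_ hz
  filter_upwards [eventually_ge_atTop R₀, eventually_gt_atTop 0] with R hR hR0
  have hsub : (Set.uIcc (-R) 0 ×ℂ Set.uIcc (-R) R) ⊆ {z : ℂ | z.re ≤ 0} := by
    intro z hz
    rw [mem_reProdIm, Set.uIcc_of_le (by linarith)] at hz
    exact hz.1.2
  have key := integral_boundary_rect_eq_zero_of_differentiableOn g (⟨-R, -R⟩ : ℂ) (⟨0, R⟩ : ℂ)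
    (hd.mono hsub)
  simp only [ofReal_zero, zero_add] at key
  have hC : ∀ z : ℂ, z.re ≤ 0 → R ≤ ‖z‖ → ‖g z‖ ≤ C / R ^ 2 := by
    intro z hz hzR
    have h₁ := hb z hz (hR.trans hzR)
    have hC0 : 0 ≤ C := by
      have := (norm_nonneg _).trans h₁
      by_contra hneg
      have : C / ‖z‖ ^ 2 < 0 := div_neg_of_neg_of_pos (not_le.1 hneg)
        (pow_pos (hR0.trans_le hzR) 2)
      linarith
    refine h₁.trans ?_
    gcongr
  have hor : ∀ s : ℝ, |s| = R → ‖∫ x : ℝ in -R..0, g (x + s * I)‖ ≤ C / R := by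
    intro s hs
    have := intervalIntegral.norm_integral_le_of_norm_le_const (a := -R) (b := 0)
      (f := fun x : ℝ => g (x + s * I)) (C := C / R ^ 2) (by
        intro x hx
        rw [Set.uIoc_of_le (by linarith)] at hx
        refine hC _ (by simpa using hx.2) ?_
        rw [← hs]
        simpa using abs_im_le_norm ((x : ℂ) + s * I))
    refine this.trans (le_of_eq ?_)
    rw [zero_sub, neg_neg, abs_of_pos hR0]
    field_simp
  have hver : ‖∫ y : ℝ in -R..R, g ((-R : ℝ) + y * I)‖ ≤ 2 * (C / R) := by
    have := intervalIntegral.norm_integral_le_of_norm_le_const (a := -R) (b := R)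
      (f := fun y : ℝ => g ((-R : ℝ) + y * I)) (C := C / R ^ 2) (by
        intro y _
        refine hC _ (by simpa using hR0.le) ?_
        have := abs_re_le_norm (((-R : ℝ) : ℂ) + y * I)
        simpa [abs_of_pos hR0] using this)
    refine this.trans (le_of_eq ?_)
    rw [sub_neg_eq_add, abs_of_pos (by linarith)]
    field_simp
    ring
  have h₁ := hor (-R) (by rw [abs_neg, abs_of_pos hR0])
  have h₂ := hor R (abs_of_pos hR0)
  have heq : I • ∫ y : ℝ in -R..R, g (y * I) =
      (∫ x : ℝ in -R..0, g (x + R * I)) - (∫ x : ℝ in -R..0, g (x + (-R : ℝ) * I)) +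
        I • ∫ y : ℝ in -R..R, g ((-R : ℝ) + y * I) := by
    rw [← sub_eq_zero, ← key]
    abel
  have hn : ‖∫ y : ℝ in -R..R, g (y * I)‖ = ‖I • ∫ y : ℝ in -R..R, g (y * I)‖ := by
    rw [norm_smul, norm_I, one_mul]
  change ‖∫ y : ℝ in -R..R, g (y * I)‖ ≤ _
  rw [hn, heq]
  calc _ ≤ C / R + C / R + 1 * (2 * (C / R)) := by
        refine (norm_add_le _ _).trans (add_le_add ((norm_sub_le _ _).trans (add_le_add h₂ h₁)) ?_)
        rw [norm_smul, norm_I]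
        gcongr
    _ = _ := by ring

theorem integral_poisson_kernel {x : ℝ} (hx : 0 < x) (y : ℝ) :
    ∫ t : ℝ, 2 * x / (x ^ 2 + (t - y) ^ 2) = 2 * Real.pi := by
  have h₁ : ∀ t : ℝ, 2 * x / (x ^ 2 + (t - y) ^ 2) = (2 / x) * (1 + ((t - y) / x) ^ 2)⁻¹ := by
    intro t
    have : 0 < x ^ 2 + (t - y) ^ 2 := by positivity
    have : 0 < 1 + ((t - y) / x) ^ 2 := by positivity
    field_simp
  simp_rw [h₁]
  rw [integral_const_mul, integral_sub_right_eq_self (fun t : ℝ => (1 + (t / x) ^ 2)⁻¹) y,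
    Measure.integral_comp_div (fun t : ℝ => (1 + t ^ 2)⁻¹) x, integral_univ_inv_one_add_sq,
    abs_of_pos hx, smul_eq_mul]
  field_simp

theorem integrable_poisson_kernel {x : ℝ} (hx : 0 < x) (y : ℝ) :
    Integrable fun t : ℝ => 2 * x / (x ^ 2 + (t - y) ^ 2) := by
  by_contra h
  have := integral_poisson_kernel hx y
  rw [integral_undef h] at this
  have := Real.pi_pos
  linarith

theorem rpow_bound_of_div {E : Type*} [NormedAddCommGroup E] {G : ℂ → E} {C : ℝ}
    (hb : ∀ z : ℂ, z.re ≤ 0 → ‖G z‖ ≤ C / (1 + ‖z‖)) (t : ℝ) :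
    ‖G (t * I)‖ ≤ C * (1 + |t|) ^ (-1 : ℝ) := by
  simpa [Real.rpow_neg_one, div_eq_mul_inv] using hb (t * I) (by simp)

theorem continuous_comp_axis {f : ℂ → E} (hd : DifferentiableOn ℂ f {z | z.re ≤ 0}) :
    Continuous fun t : ℝ => f (t * I) :=
  hd.continuousOn.comp_continuous (by fun_prop) fun t => by simp

/-- The Cauchy integral over the imaginary axis of a function that is holomorphic in the left
half-plane vanishes in the right half-plane. -/
theorem integral_cauchy_axis_of_pos {f : ℂ → E} (hd : DifferentiableOn ℂ f {z | z.re ≤ 0})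
    {C : ℝ} (hb : ∀ z : ℂ, z.re ≤ 0 → ‖f z‖ ≤ C / (1 + ‖z‖)) {z : ℂ} (hz : 0 < z.re) :
    ∫ t : ℝ, ((t : ℂ) * I - z)⁻¹ • f (t * I) = 0 := by
  have hC : 0 ≤ C := by
    simpa using (norm_nonneg _).trans (hb 0 (by simp))
  -- Beyond this radius ‖w - z‖ ≥ ‖w‖ / 2, which costs the factor 2; the `+ 1` keeps ‖w‖ positive.
  refine integral_axis_eq_zero (g := fun w => (w - z)⁻¹ • f w) (C := 2 * C) (R₀ := 2 * ‖z‖ + 1)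
    ?_ (integrable_inv_smul_of_decay (continuous_comp_axis hd) one_pos (rpow_bound_of_div hb)
      hz.ne') ?_
  · refine DifferentiableOn.smul (DifferentiableOn.inv (by fun_prop) fun w hw h => ?_) hd
    rw [sub_eq_zero] at h
    rw [h] at hw
    exact absurd hw (not_le.2 hz)
  · intro w hw hwR
    have h₁ : ‖w‖ ≤ ‖w - z‖ + ‖z‖ := by simpa using norm_add_le (w - z) z
    have h₂ : ‖w‖ / 2 ≤ ‖w - z‖ := by linarith
    have h₃ : 0 < ‖w‖ := by linarith [norm_nonneg z]
    rw [norm_smul, norm_inv]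
    calc ‖w - z‖⁻¹ * ‖f w‖ ≤ (‖w‖ / 2)⁻¹ * (C / ‖w‖) := by
          gcongr
          refine (hb w hw).trans ?_
          gcongr
          linarith
      _ = _ := by field_simp

/-- The Cauchy integral formula for the left half-plane. -/
theorem integral_cauchy_axis_of_neg [CompleteSpace E] {f : ℂ → E}
    (hd : DifferentiableOn ℂ f {z | z.re ≤ 0})
    {C : ℝ} (hb : ∀ z : ℂ, z.re ≤ 0 → ‖f z‖ ≤ C / (1 + ‖z‖)) {z : ℂ} (hz : z.re < 0) :
    ∫ t : ℝ, ((t : ℂ) * I - z)⁻¹ • f (t * I) = (2 * Real.pi) • f z := by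
  have hC : 0 ≤ C := by
    simpa using (norm_nonneg _).trans (hb 0 (by simp))
  -- The mirror image of z in the axis. Subtracting f(z)(z - a)/(w - a), which is holomorphic on the
  -- left and equals f(z) at w = z, removes the pole while keeping quadratic decay. On the axis the
  -- subtracted term becomes the Poisson kernel, of total mass 2π.
  set a : ℂ := ⟨-z.re, z.im⟩ with ha
  have hane : ∀ w : ℂ, w.re ≤ 0 → w - a ≠ 0 := by
    intro w hw h
    have : w.re + z.re = 0 := by simpa [ha] using congrArg re h
    linarith
  set h : ℂ → E := fun w => f w - ((z - a) / (w - a)) • f z with hh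
  have hhd : DifferentiableOn ℂ h {z | z.re ≤ 0} :=
    hd.sub (DifferentiableOn.smul_const
      (DifferentiableOn.div (by fun_prop) (by fun_prop) fun w hw => hane w hw) _)
  have hhz : h z = 0 := by
    simp [hh, div_self (hane z hz.le)]
  have hnhds : {z : ℂ | z.re ≤ 0} ∈ 𝓝 z :=
    mem_of_superset ((isOpen_lt continuous_re continuous_const).mem_nhds hz) fun w (hw : w.re < 0) =>
      hw.le
  have hslope : ∀ w, w ≠ z → dslope h z w = (w - z)⁻¹ • h w := by
    intro w hw
    rw [dslope_of_ne _ hw, slope_def_module, hhz, sub_zero]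
  have hkernel : ∀ t : ℝ, ((t : ℂ) * I - z)⁻¹ * ((z - a) / ((t : ℂ) * I - a)) =
      ((2 * (-z.re) / ((-z.re) ^ 2 + (t - z.im) ^ 2) : ℝ) : ℂ) := by
    intro t
    have h₁ : ((t : ℂ) * I - z) * ((t : ℂ) * I - a) =
        -(((-z.re) ^ 2 + (t - z.im) ^ 2 : ℝ) : ℂ) := by
      apply Complex.ext <;> simp [ha, pow_two] <;> ring
    have h₂ : z - a = -((2 * (-z.re) : ℝ) : ℂ) := by
      apply Complex.ext <;> simp [ha]; ring
    rw [inv_mul_eq_div, div_div, mul_comm ((t : ℂ) * I - a), h₁, h₂, neg_div_neg_eq, ofReal_div]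
  have hpt : ∀ t : ℝ, dslope h z (t * I) = ((t : ℂ) * I - z)⁻¹ • f (t * I) -
      (2 * (-z.re) / ((-z.re) ^ 2 + (t - z.im) ^ 2) : ℝ) • f z := by
    intro t
    rw [hslope _ (sub_ne_zero.1 (ofReal_mul_I_sub_ne_zero hz.ne t)), hh, smul_sub, smul_smul,
      hkernel, coe_smul]
  have hi₁ := integrable_inv_smul_of_decay (continuous_comp_axis hd) one_pos (rpow_bound_of_div hb)
    hz.ne
  have hi₂ := (integrable_poisson_kernel (neg_pos.2 hz) z.im).smul_const (f z)
  have hzero : ∫ t : ℝ, dslope h z (t * I) = 0 := by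
    refine integral_axis_eq_zero (C := 2 * (C + 2 * (‖z - a‖ * ‖f z‖)))
      (R₀ := 2 * ‖z‖ + 2 * ‖a‖ + 1) ((differentiableOn_dslope hnhds).2 hhd) ?_ ?_
    · exact (hi₁.sub hi₂).congr (Eventually.of_forall fun t => (hpt t).symm)
    · intro w hw hwR
      have h₁ : ‖w‖ ≤ ‖w - z‖ + ‖z‖ := by simpa using norm_add_le (w - z) z
      have h₁' : ‖w‖ ≤ ‖w - a‖ + ‖a‖ := by simpa using norm_add_le (w - a) a
      have hnz := norm_nonneg z
      have hna := norm_nonneg a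
      have h₂ : ‖w‖ / 2 ≤ ‖w - z‖ := by linarith
      have h₂' : ‖w‖ / 2 ≤ ‖w - a‖ := by linarith
      have h₃ : 0 < ‖w‖ := by linarith
      have hwz : w ≠ z := by
        rintro rfl
        linarith
      rw [hslope w hwz, norm_smul, norm_inv]
      have h₄ : ‖h w‖ ≤ C / ‖w‖ + (‖z - a‖ / (‖w‖ / 2)) * ‖f z‖ := by
        refine (norm_sub_le _ _).trans ?_
        rw [norm_smul, norm_div]
        gcongr
        refine (hb w hw).trans ?_
        gcongr
        linarith
      calc ‖w - z‖⁻¹ * ‖h w‖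
          ≤ (‖w‖ / 2)⁻¹ * (C / ‖w‖ + (‖z - a‖ / (‖w‖ / 2)) * ‖f z‖) := by gcongr
        _ = _ := by field_simp
  simp_rw [hpt] at hzero
  rw [integral_sub hi₁ hi₂, integral_smul_const, integral_poisson_kernel (neg_pos.2 hz),
    sub_eq_zero] at hzero
  exact hzero

theorem integral_cauchy_axis_reflect (f : ℂ → E) (z : ℂ) :
    ∫ t : ℝ, ((t : ℂ) * I - z)⁻¹ • f (t * I) =
      -∫ t : ℝ, ((t : ℂ) * I - -z)⁻¹ • f (-(t * I)) := by
  rw [← integral_neg, ← integral_neg_eq_self]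
  refine integral_congr_ae (Eventually.of_forall fun t => ?_)
  simp only [ofReal_neg, neg_mul]
  rw [← neg_smul, ← inv_neg]
  congr 2
  ring

theorem differentiableOn_comp_neg {f : ℂ → E} (hd : DifferentiableOn ℂ f {z | 0 ≤ z.re}) :
    DifferentiableOn ℂ (fun w => f (-w)) {z | z.re ≤ 0} :=
  hd.comp (by fun_prop) fun w hw => by simpa using hw

theorem integral_cauchy_axis_right_of_neg {f : ℂ → E} (hd : DifferentiableOn ℂ f {z | 0 ≤ z.re})
    {C : ℝ} (hb : ∀ z : ℂ, 0 ≤ z.re → ‖f z‖ ≤ C / (1 + ‖z‖)) {z : ℂ} (hz : z.re < 0) :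
    ∫ t : ℝ, ((t : ℂ) * I - z)⁻¹ • f (t * I) = 0 := by
  rw [integral_cauchy_axis_reflect, neg_eq_zero]
  exact integral_cauchy_axis_of_pos (f := fun w => f (-w)) (differentiableOn_comp_neg hd) (C := C)
    (fun w hw => by simpa using hb (-w) (by simpa using hw)) (by simpa using hz)

theorem integral_cauchy_axis_right_of_pos [CompleteSpace E] {f : ℂ → E}
    (hd : DifferentiableOn ℂ f {z | 0 ≤ z.re})
    {C : ℝ} (hb : ∀ z : ℂ, 0 ≤ z.re → ‖f z‖ ≤ C / (1 + ‖z‖)) {z : ℂ} (hz : 0 < z.re) :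
    ∫ t : ℝ, ((t : ℂ) * I - z)⁻¹ • f (t * I) = -((2 * Real.pi) • f z) := by
  rw [integral_cauchy_axis_reflect, neg_inj]
  simpa using integral_cauchy_axis_of_neg (f := fun w => f (-w)) (differentiableOn_comp_neg hd)
    (C := C) (fun w hw => by simpa using hb (-w) (by simpa using hw)) (z := -z) (by simpa using hz)

end HalfPlaneCauchy

/-! ### The Cauchy transform of a function on the imaginary axis. -/

section CauchyTransform

variable {E : Type*} [NormedAddCommGroup E] [NormedSpace ℂ E]

/-- The Cauchy transform of a function on the imaginary axis, which is parametrized by `t ↦ it`. -/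
noncomputable def cauchyTransform (G : ℝ → E) (z : ℂ) : E :=
  (2 * Real.pi : ℂ)⁻¹ • ∫ t : ℝ, ((t : ℂ) * I - z)⁻¹ • G t

theorem map_cauchyTransform [CompleteSpace E] {F : Type*} [NormedAddCommGroup F]
    [NormedSpace ℂ F] [CompleteSpace F] (L : E →L[ℂ] F) {G : ℝ → E} {z : ℂ}
    (hi : Integrable fun t : ℝ => ((t : ℂ) * I - z)⁻¹ • G t) :
    L (cauchyTransform G z) = cauchyTransform (fun t => L (G t)) z := by
  rw [cauchyTransform, map_smul, ← L.integral_comp_comm hi, cauchyTransform]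
  simp only [map_smul]

theorem cauchyTransform_sub {G H : ℝ → E} {z : ℂ}
    (hG : Integrable fun t : ℝ => ((t : ℂ) * I - z)⁻¹ • G t)
    (hH : Integrable fun t : ℝ => ((t : ℂ) * I - z)⁻¹ • H t) :
    cauchyTransform (fun t => G t - H t) z = cauchyTransform G z - cauchyTransform H z := by
  simp only [cauchyTransform, smul_sub]
  rw [integral_sub hG hH, smul_sub]

theorem norm_inv_two_pi_le_one : ‖(2 * Real.pi : ℂ)⁻¹‖ ≤ 1 := by
  have h := Real.pi_gt_three
  have h2 : ‖(2 * Real.pi : ℂ)‖ = 2 * Real.pi := by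
    rw [norm_mul, norm_real, Real.norm_eq_abs, abs_of_pos Real.pi_pos]
    simp
  rw [norm_inv, h2]
  exact inv_le_one_of_one_le₀ (by linarith)

theorem norm_cauchyTransform_le {G : ℝ → E} (hG : Integrable G) {z : ℂ} {δ : ℝ} (hδ : 0 < δ)
    (hz : δ ≤ |z.re|) : ‖cauchyTransform G z‖ ≤ δ⁻¹ * ∫ t, ‖G t‖ := by
  rw [cauchyTransform, norm_smul, ← integral_const_mul]
  refine (mul_le_of_le_one_left (norm_nonneg _) norm_inv_two_pi_le_one).trans ?_
  refine norm_integral_le_of_norm_le (hG.norm.const_mul _) (Eventually.of_forall fun t => ?_)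
  rw [norm_smul, norm_inv]
  have h₁ : |z.re| ≤ ‖(t : ℂ) * I - z‖ := by
    simpa using abs_re_le_norm ((t : ℂ) * I - z)
  gcongr
  exact hz.trans h₁

/-- Differentiation under the integral, dominated on the ball of radius |Re z| / 2, which stays at
that distance from the axis. -/
theorem differentiableAt_cauchyTransform {G : ℝ → E} (hG : Continuous G)
    {C r : ℝ} (hr : 0 < r) (hb : ∀ t, ‖G t‖ ≤ C * (1 + |t|) ^ (-r)) {z : ℂ} (hz : z.re ≠ 0) :
    DifferentiableAt ℂ (cauchyTransform G) z := by
  have hC : 0 ≤ C := by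
    simpa using (norm_nonneg _).trans (hb 0)
  set δ := |z.re| / 2 with hδ
  have hδ0 : 0 < δ := by have := abs_pos.2 hz; positivity
  have hball : ∀ w ∈ Metric.ball z δ, δ ≤ |w.re| ∧ ‖w‖ ≤ ‖z‖ + δ := by
    intro w hw
    rw [Metric.mem_ball, dist_eq_norm] at hw
    have h₁ : |w.re - z.re| ≤ ‖w - z‖ := by simpa using abs_re_le_norm (w - z)
    have h₂ := abs_sub_abs_le_abs_sub z.re w.re
    rw [abs_sub_comm] at h₂
    have h₃ : ‖w‖ ≤ ‖w - z‖ + ‖z‖ := by simpa using norm_add_le (w - z) z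
    constructor <;> linarith
  have hne : ∀ w ∈ Metric.ball z δ, w.re ≠ 0 := fun w hw =>
    abs_pos.1 (hδ0.trans_le (hball w hw).1)
  have key := hasDerivAt_integral_of_dominated_loc_of_deriv_le (μ := volume)
    (F := fun w (t : ℝ) => ((t : ℂ) * I - w)⁻¹ • G t)
    (F' := fun w (t : ℝ) => (((t : ℂ) * I - w)⁻¹ * ((t : ℂ) * I - w)⁻¹) • G t)
    (bound := fun t => (δ⁻¹ * (((1 + (‖z‖ + δ)) / δ + 1) * C)) * (1 + |t|) ^ (-(r + 1)))
    (Metric.ball_mem_nhds z hδ0)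
    (by
      filter_upwards [Metric.ball_mem_nhds z hδ0] with w hw
      exact ((continuous_inv_axis_sub (hne w hw)).smul hG).aestronglyMeasurable)
    (integrable_inv_smul_of_decay hG hr hb hz)
    (((continuous_inv_axis_sub hz).mul (continuous_inv_axis_sub hz)).smul hG).aestronglyMeasurable
    (Eventually.of_forall fun t w hw => by
      obtain ⟨h₁, h₂⟩ := hball w hw
      have h₃ : |w.re| ≤ ‖(t : ℂ) * I - w‖ := by
        simpa using abs_re_le_norm ((t : ℂ) * I - w)
      have h₄ : ‖((t : ℂ) * I - w)⁻¹‖ ≤ ((1 + (‖z‖ + δ)) / δ + 1) * (1 + |t|)⁻¹ := by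
        refine (norm_inv_axis_sub_le w (hne w hw) t).trans ?_
        gcongr
      have h₅ : ‖((t : ℂ) * I - w)⁻¹‖ ≤ δ⁻¹ := by
        rw [norm_inv]
        gcongr
        exact h₁.trans h₃
      have h₆ : 0 < 1 + |t| := by positivity
      rw [norm_smul, norm_mul, neg_add, Real.rpow_add h₆, Real.rpow_neg_one]
      calc _ ≤ (δ⁻¹ * (((1 + (‖z‖ + δ)) / δ + 1) * (1 + |t|)⁻¹)) * (C * (1 + |t|) ^ (-r)) := by
            gcongr
            exact hb t
        _ = _ := by ring)
    ((integrable_one_add_abs_rpow (r := r + 1) (by linarith)).const_mul _)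
    (Eventually.of_forall fun t w hw => by
      have h₁ := ofReal_mul_I_sub_ne_zero (hne w hw) t
      have h₂ : HasDerivAt (fun w : ℂ => (t : ℂ) * I - w) (-1) w := by
        simpa using (hasDerivAt_id w).const_sub ((t : ℂ) * I)
      have h₃ := (h₂.inv h₁).smul_const (G t)
      rwa [neg_neg, one_div, pow_two, mul_inv] at h₃)
  exact (key.2.const_smul (2 * Real.pi : ℂ)⁻¹).differentiableAt

end CauchyTransform

/-! ### The spectral projections as a Cauchy transform of the resolvent. -/

section SpectralProjection

theorem differentiableOn_resolvent_apply {X Y : Type*} [NormedAddCommGroup X] [NormedSpace ℂ X]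
    [NormedAddCommGroup Y] [NormedSpace ℂ Y] [CompleteSpace Y] {V : Y →ₗ.[ℂ] Y} {H : Set ℂ}
    (hH : H ⊆ resolventSet V) (L : Y →L[ℂ] X) (y : Y) :
    DifferentiableOn ℂ (fun z => L (resolvent V z y)) H := fun z hz =>
  (L.differentiableAt.comp z ((differentiableAt_resolvent (hH hz)).clm_apply
    (differentiableAt_const y))).differentiableWithinAt

/-- On domain vectors z(V - z)⁻¹y = (V - z)⁻¹Vy - y stays bounded. A merely bounded resolvent thus
gains the decay that the Cauchy formulas need, which is why the formulas are proved on the domain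
and extended by density. -/
theorem exists_norm_resolvent_apply_le {Y : Type*} [NormedAddCommGroup Y] [NormedSpace ℂ Y]
    {V : Y →ₗ.[ℂ] Y} {H : Set ℂ} (hH : H ⊆ resolventSet V) {M : ℝ}
    (hM : ∀ z ∈ H, ‖resolvent V z‖ ≤ M) (y : V.domain) :
    ∃ C, ∀ z ∈ H, ‖resolvent V z y‖ ≤ C / (1 + ‖z‖) := by
  refine ⟨M * ‖(y : Y)‖ + M * ‖V y‖ + ‖(y : Y)‖, fun z hz => ?_⟩
  have h₁ := resolvent_apply_sub (hH hz) y
  rw [map_sub, map_smul, sub_eq_iff_eq_add] at h₁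
  have h₂ : z • resolvent V z y = resolvent V z (V y) - y := by rw [h₁]; abel
  have h₃ : ‖z‖ * ‖resolvent V z y‖ ≤ M * ‖V y‖ + ‖(y : Y)‖ := by
    rw [← norm_smul, h₂]
    exact (norm_sub_le _ _).trans
      (add_le_add_left ((resolvent V z).le_of_opNorm_le (hM z hz) _) _)
  have h₄ := (resolvent V z).le_of_opNorm_le (hM z hz) y
  rw [le_div_iff₀ (by positivity)]
  linarith

variable {X : Type*} [NormedAddCommGroup X] [NormedSpace ℂ X]

theorem IsDichotomousWrt.left_subset {S : X →ₗ.[ℂ] X} {Xp Xm : Submodule ℂ X}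
    (hS : IsDichotomousWrt S Xp Xm) :
    {z : ℂ | z.re ≤ 0} ⊆ resolventSet (restriction S Xp hS.invariant_pos) := by
  intro z hz
  by_contra h
  exact (not_lt.2 (show z.re ≤ 0 from hz)) (hS.spectrum_pos h)

theorem IsDichotomousWrt.right_subset {S : X →ₗ.[ℂ] X} {Xp Xm : Submodule ℂ X}
    (hS : IsDichotomousWrt S Xp Xm) :
    {z : ℂ | 0 ≤ z.re} ⊆ resolventSet (restriction S Xm hS.invariant_neg) := by
  intro z hz
  by_contra h
  exact (not_lt.2 (show 0 ≤ z.re from hz)) (hS.spectrum_neg h)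

/-- The resolvent of a restriction of `S` solves the resolvent equation of `S`. -/
theorem exists_domain_eq_resolvent_restriction {S : X →ₗ.[ℂ] X} {U : Submodule ℂ X}
    {hU : IsInvariant S U} {z : ℂ} (hz : z ∈ resolventSet (restriction S U hU)) (y : U) :
    ∃ x : S.domain, (x : X) = resolvent (restriction S U hU) z y ∧ S x - z • (x : X) = y := by
  obtain ⟨x, hx, hy⟩ := (resolvent_spec hz).2 y
  exact ⟨⟨((x : U) : X), x.2⟩, congrArg Subtype.val hx, congrArg Subtype.val hy⟩

variable [CompleteSpace X]

theorem exists_complementary_projections {Xp Xm : Submodule ℂ X} (hp : IsClosed (Xp : Set X))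
    (hm : IsClosed (Xm : Set X)) (h : IsCompl Xp Xm) :
    ∃ (πp : X →L[ℂ] Xp) (πm : X →L[ℂ] Xm), (∀ x : Xp, πp x = x) ∧ (∀ x : Xm, πp x = 0) ∧
      (∀ x : Xp, πm x = 0) ∧ (∀ x : Xm, πm x = x) ∧ ∀ x, (πp x : X) + πm x = x := by
  have ht := Submodule.IsCompl.isTopCompl_of_isClosed h hp hm
  have ht' := Submodule.IsCompl.isTopCompl_of_isClosed h.symm hm hp
  refine ⟨Xp.projectionOntoL Xm ht, Xm.projectionOntoL Xp ht',
    fun x => Submodule.projectionOntoL_apply_left ht x,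
    fun x => Submodule.projectionOntoL_apply_right ht x,
    fun x => Submodule.projectionOntoL_apply_right ht' x,
    fun x => Submodule.projectionOntoL_apply_left ht' x, fun x => ?_⟩
  exact Submodule.projection_add_projection_eq_self h x

theorem axis_mem (t : ℝ) : (t : ℂ) * I ∈ imaginaryAxis := by
  simp [imaginaryAxis]

theorem continuous_resolvent_axis {S : X →ₗ.[ℂ] X} (h : imaginaryAxis ⊆ resolventSet S) :
    Continuous fun t : ℝ => resolvent S (t * I) :=
  continuous_iff_continuousAt.2 fun t =>
    (continuousAt_resolvent (h (axis_mem t))).comp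
      (f := fun t : ℝ => (t : ℂ) * I) (by fun_prop)

/-- For a densely defined strictly dichotomous operator, the Cauchy transform of the resolvent on
the imaginary axis recovers the spectral projections. -/
theorem exists_projection_cauchyTransform {S : X →ₗ.[ℂ] X} (hdense : Dense (S.domain : Set X))
    {Xp Xm : Submodule ℂ X} (hS : IsStrictlyDichotomousWrt S Xp Xm) {C r : ℝ} (hr : 0 < r)
    (hb : ∀ t : ℝ, ‖resolvent S (t * I)‖ ≤ C * (1 + |t|) ^ (-r)) :
    ∃ (P : X →L[ℂ] X) (M : ℝ), ∀ z : ℂ, z.re ≠ 0 →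
      ‖cauchyTransform (fun t : ℝ => resolvent S (t * I)) z‖ ≤ M ∧
      (z.re < 0 → ∀ y : S.domain,
        cauchyTransform (fun t : ℝ => resolvent S (t * I)) z (S y - z • (y : X)) = P y) ∧
      (0 < z.re → ∀ y : S.domain,
        cauchyTransform (fun t : ℝ => resolvent S (t * I)) z (S y - z • (y : X)) = P y - y) := by
  obtain ⟨πp, πm, hpp, hpm, hmp, hmm, hadd⟩ :=
    exists_complementary_projections hS.isClosed_pos hS.isClosed_neg hS.isCompl
  have : CompleteSpace Xp := hS.isClosed_pos.completeSpace_coe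
  have : CompleteSpace Xm := hS.isClosed_neg.completeSpace_coe
  obtain ⟨Mp, hMp⟩ := hS.bounded_pos
  obtain ⟨Mm, hMm⟩ := hS.bounded_neg
  have hρp := hS.left_subset
  have hρm := hS.right_subset
  set Sp := restriction S Xp hS.invariant_pos
  set Sm := restriction S Xm hS.invariant_neg
  have hdec : ∀ z ∈ imaginaryAxis, ∀ y : X,
      resolvent S z y = (resolvent Sp z (πp y) : X) + resolvent Sm z (πm y) := by
    intro z hz y
    obtain ⟨a, ha, ha'⟩ := exists_domain_eq_resolvent_restriction (hρp (le_of_eq hz)) (πp y)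
    obtain ⟨b, hb, hb'⟩ := exists_domain_eq_resolvent_restriction (hρm (ge_of_eq hz)) (πm y)
    rw [← ha, ← hb]
    refine resolvent_eq_of_rightInverse (hS.axis_subset hz) (x := a + b) ?_
    rw [S.map_add, Submodule.coe_add, smul_add, ← hadd y, ← ha', ← hb']
    abel
  have h0 : (0 : ℂ) ∈ imaginaryAxis := by simp [imaginaryAxis]
  -- The projections preserve the domain because y = S⁻¹Sy and S⁻¹ splits along X₊ ⊕ X₋.
  have hdp : ∀ y : S.domain, πp y ∈ Sp.domain := by
    intro y
    have h₁ := resolvent_apply_sub (hS.axis_subset h0) y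
    rw [hdec 0 h0] at h₁
    rw [← h₁, map_add, hpp, hpm, add_zero]
    exact resolvent_mem_domain (hρp (le_of_eq h0)) _
  have hdm : ∀ y : S.domain, πm y ∈ Sm.domain := by
    intro y
    have h₁ := resolvent_apply_sub (hS.axis_subset h0) y
    rw [hdec 0 h0] at h₁
    rw [← h₁, map_add, hmp, hmm, zero_add]
    exact resolvent_mem_domain (hρm (ge_of_eq h0)) _
  have hsub : ∀ (y : S.domain) (z : ℂ), S y - z • (y : X) =
      ((Sp ⟨πp y, hdp y⟩ - z • πp y : Xp) : X) + (Sm ⟨πm y, hdm y⟩ - z • πm y : Xm) := by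
    intro y z
    have h₁ : y = ⟨(πp y : X), hdp y⟩ + ⟨(πm y : X), hdm y⟩ := Subtype.ext (hadd y).symm
    have h₂ : S y = (Sp ⟨πp y, hdp y⟩ : X) + (Sm ⟨πm y, hdm y⟩ : X) := by
      change S y = S ⟨(πp y : X), hdp y⟩ + S ⟨(πm y : X), hdm y⟩
      rw [← S.map_add, ← h₁]
    have h₃ : z • (y : X) = z • (πp y : X) + z • (πm y : X) := by rw [← smul_add, hadd]
    rw [h₂, h₃, Submodule.coe_sub, Submodule.coe_sub, Submodule.coe_smul, Submodule.coe_smul]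
    abel
  have hcont := continuous_resolvent_axis hS.axis_subset
  have hint : ∀ z : ℂ, z.re ≠ 0 →
      Integrable fun t : ℝ => ((t : ℂ) * I - z)⁻¹ • resolvent S (t * I) := fun z hz =>
    integrable_inv_smul_of_decay hcont hr hb hz
  have hπ : (2 * Real.pi : ℂ) ≠ 0 := by
    exact_mod_cast (by positivity : (2 * Real.pi : ℝ) ≠ 0)
  -- The X₊ part of the resolvent is holomorphic on the left and the X₋ part on the right. Only the
  -- part holomorphic on the side of z survives the integral; the sign comes from the orientation of
  -- the axis.
  have hformula : ∀ z : ℂ, z.re ≠ 0 → ∀ u : S.domain,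
      (2 * Real.pi : ℂ) • cauchyTransform (fun t : ℝ => resolvent S (t * I)) z u =
        (if z.re < 0 then (2 * Real.pi) • (resolvent Sp z (πp u) : X)
          else -((2 * Real.pi) • (resolvent Sm z (πm u) : X))) := by
    intro z hz u
    obtain ⟨Cp, hCp⟩ := exists_norm_resolvent_apply_le hρp hMp ⟨_, hdp u⟩
    obtain ⟨Cm, hCm⟩ := exists_norm_resolvent_apply_le hρm hMm ⟨_, hdm u⟩
    have hfp := differentiableOn_resolvent_apply hρp Xp.subtypeL (πp u)
    have hfm := differentiableOn_resolvent_apply hρm Xm.subtypeL (πm u)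
    have hcm : Continuous fun t : ℝ => Xm.subtypeL (resolvent Sm (t * I) (πm u)) :=
      hfm.continuousOn.comp_continuous (by fun_prop) fun t => by simp
    have hip := integrable_inv_smul_of_decay (continuous_comp_axis hfp) one_pos
      (rpow_bound_of_div hCp) hz
    have him := integrable_inv_smul_of_decay (C := Cm) (r := 1) hcm one_pos
      (fun t => by simpa [Real.rpow_neg_one, div_eq_mul_inv] using hCm (t * I) (by simp)) hz
    have h₁ := map_cauchyTransform (ContinuousLinearMap.apply ℂ X (u : X)) (hint z hz)
    rw [ContinuousLinearMap.apply_apply] at h₁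
    rw [h₁, cauchyTransform, smul_inv_smul₀ hπ]
    have h₂ : ∀ t : ℝ, ((t : ℂ) * I - z)⁻¹ •
        ContinuousLinearMap.apply ℂ X (u : X) (resolvent S (t * I)) =
        ((t : ℂ) * I - z)⁻¹ • Xp.subtypeL (resolvent Sp (t * I) (πp u)) +
          ((t : ℂ) * I - z)⁻¹ • Xm.subtypeL (resolvent Sm (t * I) (πm u)) := by
      intro t
      rw [ContinuousLinearMap.apply_apply, hdec _ (axis_mem t), smul_add]
      rfl
    simp_rw [h₂]
    rw [integral_add hip him]
    rcases hz.lt_or_gt with hneg | hpos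
    · rw [if_pos hneg, integral_cauchy_axis_of_neg hfp hCp hneg,
        integral_cauchy_axis_right_of_neg hfm hCm hneg, add_zero]
      rfl
    · rw [if_neg hpos.not_gt, integral_cauchy_axis_of_pos hfp hCp hpos,
        integral_cauchy_axis_right_of_pos hfm hCm hpos, zero_add]
      rfl
  have hleft : ∀ z : ℂ, z.re < 0 →
      cauchyTransform (fun t : ℝ => resolvent S (t * I)) z =
        Xp.subtypeL ∘L resolvent Sp z ∘L πp := by
    intro z hz
    refine ContinuousLinearMap.ext_on (hdense.mono Submodule.subset_span) fun u hu => ?_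
    have := hformula z hz.ne ⟨u, hu⟩
    rw [if_pos hz, ← coe_smul, ofReal_mul, ofReal_ofNat] at this
    exact smul_right_injective _ hπ this
  have hright : ∀ z : ℂ, 0 < z.re →
      cauchyTransform (fun t : ℝ => resolvent S (t * I)) z =
        -(Xm.subtypeL ∘L resolvent Sm z ∘L πm) := by
    intro z hz
    refine ContinuousLinearMap.ext_on (hdense.mono Submodule.subset_span) fun u hu => ?_
    have := hformula z hz.ne' ⟨u, hu⟩
    rw [if_neg hz.not_gt, ← coe_smul, ofReal_mul, ofReal_ofNat, ← smul_neg] at this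
    exact smul_right_injective _ hπ this
  have hMp0 : 0 ≤ Mp := (norm_nonneg _).trans (hMp 0 (by simp))
  have hMm0 : 0 ≤ Mm := (norm_nonneg _).trans (hMm 0 (by simp))
  refine ⟨Xp.subtypeL ∘L πp, Mp * ‖πp‖ + Mm * ‖πm‖, fun z hz => ⟨?_, fun hneg y => ?_,
    fun hpos y => ?_⟩⟩
  · refine ContinuousLinearMap.opNorm_le_bound _ (by positivity) fun x => ?_
    rcases hz.lt_or_gt with hneg | hpos
    · rw [hleft z hneg]
      calc ‖resolvent Sp z (πp x)‖ ≤ Mp * (‖πp‖ * ‖x‖) :=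
            ((resolvent Sp z).le_of_opNorm_le (hMp z hneg.le) _).trans
              (by gcongr; exact πp.le_opNorm x)
        _ = Mp * ‖πp‖ * ‖x‖ := by ring
        _ ≤ _ := by gcongr; exact le_add_of_nonneg_right (by positivity)
    · rw [hright z hpos, neg_apply, norm_neg]
      calc ‖resolvent Sm z (πm x)‖ ≤ Mm * (‖πm‖ * ‖x‖) :=
            ((resolvent Sm z).le_of_opNorm_le (hMm z hpos.le) _).trans
              (by gcongr; exact πm.le_opNorm x)
        _ = Mm * ‖πm‖ * ‖x‖ := by ring
        _ ≤ _ := by gcongr; exact le_add_of_nonneg_left (by positivity)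
  · rw [hleft z hneg, hsub y z]
    simp only [ContinuousLinearMap.comp_apply, map_add, hpp, hpm, map_zero, add_zero]
    exact congrArg Subtype.val (resolvent_apply_sub (hρp hneg.le) ⟨_, hdp y⟩)
  · rw [hright z hpos, hsub y z]
    simp only [ContinuousLinearMap.comp_apply, neg_apply, map_add, hmp, hmm, map_zero, neg_zero,
      zero_add]
    have := congrArg Subtype.val (resolvent_apply_sub (hρm hpos.le) ⟨_, hdm y⟩)
    change -(resolvent Sm z (Sm ⟨πm y, hdm y⟩ - z • πm y) : X) = (πp y : X) - y
    rw [this]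
    nth_rewrite 3 [← hadd y]
    change -(πm y : X) = _
    abel

end SpectralProjection

/-! ### Partial resolvents and the decomposition that they induce. -/

section PartialResolvent

variable {X : Type*} [NormedAddCommGroup X] [NormedSpace ℂ X]

/-- `N` behaves like `(T - z)⁻¹ Q`, where `Q` is thought of as a projection commuting with `T`. -/
structure IsPartialResolvent (T : X →ₗ.[ℂ] X) (z : ℂ) (Q N : X →L[ℂ] X) : Prop where
  apply_sub : ∀ x : T.domain, N (T x - z • (x : X)) = Q x
  exists_domain : ∀ y : X, ∃ x : T.domain, (x : X) = N y ∧ T x - z • (x : X) = Q y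

variable {T : X →ₗ.[ℂ] X} {z w : ℂ} {Q N : X →L[ℂ] X}

theorem IsPartialResolvent.apply_comm (h : IsPartialResolvent T z Q N) (y : X) :
    N (Q y) = Q (N y) := by
  obtain ⟨x, hx, hy⟩ := h.exists_domain y
  rw [← hy, h.apply_sub, hx]

/-- For x in U ∩ D(T), N Tx = Qx = x; applying T and using TN = Q gives Tx = Q Tx. -/
theorem IsPartialResolvent.isInvariant (h : IsPartialResolvent T 0 Q N) {U : Submodule ℂ X}
    (hU : ∀ x, x ∈ U ↔ Q x = x) : IsInvariant T U := by
  intro x hx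
  obtain ⟨x', hx', hy⟩ := h.exists_domain (T x)
  have h₁ := h.apply_sub x
  rw [(hU x).1 hx, zero_smul, sub_zero] at h₁
  have h₂ : x' = x := Subtype.ext (hx'.trans h₁)
  rw [h₂, zero_smul, sub_zero] at hy
  exact (hU _).2 hy.symm

theorem IsPartialResolvent.restriction (h : IsPartialResolvent T z Q N) {U : Submodule ℂ X}
    (hU : ∀ x, x ∈ U ↔ Q x = x) (hinv : IsInvariant T U) :
    z ∈ resolventSet (restriction T U hinv) ∧
      ‖resolvent (restriction T U hinv) z‖ ≤ ‖N‖ := by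
  have hmem : ∀ x : U, (N ∘L U.subtypeL) x ∈ U := by
    intro x
    rw [hU]
    change Q (N x) = N x
    rw [← h.apply_comm, (hU x).1 x.2]
  have hres : IsResolventOp (Dichotomy.restriction T U hinv) z
      ((N ∘L U.subtypeL).codRestrict U hmem) := by
    refine ⟨fun x => Subtype.ext ?_, fun y => ?_⟩
    · exact (h.apply_sub ⟨((x : U) : X), x.2⟩).trans ((hU _).1 (x : U).2)
    · obtain ⟨x, hx, hy⟩ := h.exists_domain y
      have hxU : (x : X) ∈ U := hx ▸ hmem y
      refine ⟨⟨⟨x, hxU⟩, x.2⟩, Subtype.ext hx, Subtype.ext ?_⟩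
      exact hy.trans ((hU _).1 y.2)
  refine ⟨⟨_, hres⟩, ?_⟩
  rw [resolvent_eq hres]
  exact ContinuousLinearMap.opNorm_le_bound _ (norm_nonneg _) fun x => N.le_opNorm x

theorem IsPartialResolvent.eq_resolvent_mul (h : IsPartialResolvent T z Q N)
    (hz : z ∈ resolventSet T) : N = resolvent T z * Q := by
  ext y
  obtain ⟨x, hx, hy⟩ := h.exists_domain y
  rw [← hx, mul_apply_eq_comp, resolvent_eq_of_rightInverse hz hy]

theorem isPartialResolvent_resolvent_mul (hz : z ∈ resolventSet T)
    (hcomm : Q * resolvent T z = resolvent T z * Q) :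
    IsPartialResolvent T z Q (resolvent T z * Q) := by
  refine ⟨fun x => ?_, fun y => (resolvent_spec hz).2 (Q y)⟩
  rw [← hcomm, mul_apply_eq_comp, resolvent_apply_sub hz]

/-- Both products equal N + (w - z)N(T - w)⁻¹: expand N(T - z)(T - w)⁻¹ and (T - w)⁻¹(T - z)N. This
is needed on the axis, where the partial resolvent has to be (T - w)⁻¹Q. -/
theorem IsPartialResolvent.mul_resolvent_comm (h : IsPartialResolvent T z Q N)
    (hw : w ∈ resolventSet T) (hN : N * resolvent T w = resolvent T w * N) :
    Q * resolvent T w = resolvent T w * Q := by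
  ext y
  have h₁ := h.apply_sub ⟨_, resolvent_mem_domain hw y⟩
  rw [map_resolvent hw, add_sub_assoc, ← sub_smul, map_add, map_smul] at h₁
  obtain ⟨x, hx, hy⟩ := h.exists_domain y
  have h₂ := resolvent_apply_sub hw x
  have h₃ : T x - w • (x : X) = Q y - (w - z) • (x : X) := by
    rw [← hy, sub_smul]; abel
  rw [h₃, map_sub, map_smul, sub_eq_iff_eq_add, hx] at h₂
  have h₄ : N (resolvent T w y) = resolvent T w (N y) := congrArg (fun L => L y) hN
  rw [mul_apply_eq_comp, mul_apply_eq_comp, h₂, ← h₄]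
  exact h₁.symm

/-- A left identity on a dense domain suffices: commuting N past (T - w)⁻¹ yields N = (T - w)⁻¹(Q +
(z - w)N), first on D(T) and then everywhere, so N maps into D(T). -/
theorem isPartialResolvent_of_dense (hdense : Dense (T.domain : Set X)) (hw : w ∈ resolventSet T)
    (hcomm : N * resolvent T w = resolvent T w * N)
    (h : ∀ x : T.domain, N (T x - z • (x : X)) = Q x) : IsPartialResolvent T z Q N := by
  have key : N = resolvent T w * (Q + (z - w) • N) := by
    refine ContinuousLinearMap.ext_on (hdense.mono Submodule.subset_span) fun x hx => ?_
    have h₁ := h ⟨x, hx⟩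
    have h₂ : T ⟨x, hx⟩ - z • x = (T ⟨x, hx⟩ - w • x) - (z - w) • x := by
      rw [sub_smul]; abel
    change N (T ⟨x, hx⟩ - z • x) = Q x at h₁
    rw [h₂, map_sub, map_smul, sub_eq_iff_eq_add] at h₁
    have h₃ : N x = N (resolvent T w (T ⟨x, hx⟩ - w • x)) :=
      congrArg N (resolvent_apply_sub hw ⟨x, hx⟩).symm
    rw [h₃, ← mul_apply_eq_comp, hcomm, mul_apply_eq_comp, mul_apply_eq_comp, h₁]
    rfl
  refine ⟨h, fun y => ?_⟩
  obtain ⟨x, hx, hy⟩ := (resolvent_spec hw).2 ((Q + (z - w) • N) y)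
  have hxN : (x : X) = N y := by rw [key]; exact hx
  refine ⟨x, hxN, ?_⟩
  have h₁ : (Q + (z - w) • N) y = Q y + (z - w) • N y := rfl
  rw [h₁, ← hxN, sub_smul, sub_eq_iff_eq_add] at hy
  rw [hy]
  abel

/-- The subspaces are the range and kernel of Q, the range being written as ker(1 - Q) so that both
are visibly closed. -/
theorem isStrictlyDichotomous_of_partialResolvent {M : ℝ} (haxis : imaginaryAxis ⊆ resolventSet T)
    (hQ : Q * Q = Q)
    (hleft : ∀ z : ℂ, z.re ≤ 0 → ∃ N, IsPartialResolvent T z Q N ∧ ‖N‖ ≤ M)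
    (hright : ∀ z : ℂ, 0 ≤ z.re → ∃ N, IsPartialResolvent T z (1 - Q) N ∧ ‖N‖ ≤ M) :
    IsStrictlyDichotomous T := by
  have hQQ : ∀ x, Q (Q x) = Q x := fun x => congrArg (fun L : X →L[ℂ] X => L x) hQ
  have hUp : ∀ x, x ∈ (1 - Q : X →L[ℂ] X).ker ↔ Q x = x := fun x => by
    change x - Q x = 0 ↔ Q x = x
    rw [sub_eq_zero, eq_comm]
  have hUm : ∀ x, x ∈ Q.ker ↔ (1 - Q : X →L[ℂ] X) x = x := fun x => by
    change Q x = 0 ↔ x - Q x = x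
    rw [sub_eq_self]
  obtain ⟨Np, hNp, -⟩ := hleft 0 (by simp)
  obtain ⟨Nm, hNm, -⟩ := hright 0 (by simp)
  have hip := hNp.isInvariant hUp
  have him := hNm.isInvariant hUm
  refine ⟨_, _, ⟨(1 - Q : X →L[ℂ] X).isClosed_ker, Q.isClosed_ker, ⟨?_, ?_⟩, haxis, hip, him,
    ?_, ?_⟩, ⟨M, ?_⟩, ⟨M, ?_⟩⟩
  · rw [Submodule.disjoint_def]
    intro x hx hx'
    rw [← (hUp x).1 hx]
    exact hx'
  · rw [codisjoint_iff, eq_top_iff]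
    intro x _
    rw [Submodule.mem_sup]
    refine ⟨Q x, (hUp _).2 (hQQ x), x - Q x, ?_, by abel⟩
    change Q (x - Q x) = 0
    rw [map_sub, hQQ, sub_self]
  · intro z hz
    by_contra hre
    obtain ⟨N, hN, -⟩ := hleft z (not_lt.1 hre)
    exact hz (hN.restriction hUp hip).1
  · intro z hz
    by_contra hre
    obtain ⟨N, hN, -⟩ := hright z (not_lt.1 hre)
    exact hz (hN.restriction hUm him).1
  · intro z hz
    obtain ⟨N, hN, hM⟩ := hleft z hz
    exact (hN.restriction hUp hip).2.trans hM
  · intro z hz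
    obtain ⟨N, hN, hM⟩ := hright z hz
    exact (hN.restriction hUm him).2.trans hM

end PartialResolvent

/-! ### A criterion for strict dichotomy through the Cauchy transform. -/

section Criterion

variable {X : Type*} [NormedAddCommGroup X] [NormedSpace ℂ X] [CompleteSpace X]

theorem exists_strip {T : X →ₗ.[ℂ] X} (haxis : imaginaryAxis ⊆ resolventSet T) {C : ℝ}
    (hb : ∀ t : ℝ, ‖resolvent T (t * I)‖ ≤ C) :
    ∃ h > 0, ∀ z : ℂ, |z.re| ≤ h → z ∈ resolventSet T ∧ ‖resolvent T z‖ ≤ 2 * C := by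
  have hC : 0 ≤ C := (norm_nonneg _).trans (hb 0)
  -- C + 1 rather than C, so that the width makes sense when C = 0.
  refine ⟨(2 * (C + 1))⁻¹, by positivity, fun z hz => ?_⟩
  have hsub : ‖z - z.im * I‖ = |z.re| := by
    have : z - z.im * I = (z.re : ℂ) := by apply Complex.ext <;> simp
    rw [this, norm_real, Real.norm_eq_abs]
  have hn : ‖z - z.im * I‖ * ‖resolvent T (z.im * I)‖ ≤ 1 / 2 := by
    rw [hsub]
    calc |z.re| * ‖resolvent T (z.im * I)‖ ≤ (2 * (C + 1))⁻¹ * (C + 1) := by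
          gcongr
          exact (hb _).trans (by linarith)
      _ = 1 / 2 := by field_simp
  exact ⟨mem_resolventSet_of_norm_lt (haxis (axis_mem _)) (hn.trans_lt (by norm_num)),
    (norm_resolvent_le_of_near (haxis (axis_mem _)) hn).trans (by gcongr; exact hb _)⟩

/-- Two families of partial resolvents in the two half-planes, that agree with the resolvent near
the axis, belong to complementary projections: otherwise they would glue to a bounded entire
function. -/
theorem isIdempotent_of_partialResolvent {T : X →ₗ.[ℂ] X} {Q : X →L[ℂ] X} {N : ℂ → X →L[ℂ] X}
    {h M : ℝ} (hh : 0 < h) (hstrip : ∀ z : ℂ, |z.re| ≤ h → z ∈ resolventSet T)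
    (hd : ∀ z : ℂ, z.re ≠ 0 → DifferentiableAt ℂ N z)
    (hleft : ∀ z : ℂ, z.re < 0 → IsPartialResolvent T z Q (N z) ∧ ‖N z‖ ≤ M)
    (hright : ∀ z : ℂ, 0 < z.re → IsPartialResolvent T z (1 - Q) (-N z) ∧ ‖N z‖ ≤ M)
    (haxis : ∀ t : ℝ, ‖resolvent T (t * I)‖ ≤ M)
    (hlim : Tendsto (fun t : ℝ => resolvent T (t * I)) atTop (𝓝 0)) :
    Q * Q = Q := by
  have hM : 0 ≤ M := (norm_nonneg _).trans (haxis 0)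
  -- The factors 1 - Q and Q are chosen so that the pieces agree with (T - z)⁻¹Q(1 - Q) throughout
  -- the strip.
  set f : ℂ → X →L[ℂ] X := fun z =>
    if z.re < 0 then N z * (1 - Q) else if 0 < z.re then -N z * Q
      else resolvent T z * (Q * (1 - Q)) with hf
  have hQc : (1 - Q) * Q = Q * (1 - Q) := by rw [sub_mul, mul_sub, one_mul, mul_one]
  have hfneg : ∀ z : ℂ, z.re < 0 → f z = N z * (1 - Q) := fun z hz => if_pos hz
  have hfpos : ∀ z : ℂ, 0 < z.re → f z = -N z * Q := fun z hz => by
    simp only [hf, if_neg hz.not_gt, if_pos hz]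
  have hfstrip : ∀ z : ℂ, |z.re| ≤ h → f z = resolvent T z * (Q * (1 - Q)) := by
    intro z hz
    rcases lt_trichotomy z.re 0 with hneg | h0 | hpos
    · rw [hfneg z hneg, (hleft z hneg).1.eq_resolvent_mul (hstrip z hz), mul_assoc]
    · simp [hf, h0]
    · rw [hfpos z hpos, (hright z hpos).1.eq_resolvent_mul (hstrip z hz), mul_assoc, hQc]
  have hfd : Differentiable ℂ f := by
    intro z
    rcases lt_trichotomy z.re 0 with hneg | h0 | hpos
    · have : f =ᶠ[𝓝 z] fun z => N z * (1 - Q) := by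
        filter_upwards [(isOpen_lt continuous_re continuous_const).mem_nhds hneg] with w hw
        exact hfneg w hw
      exact ((hd z hneg.ne).mul_const _).congr_of_eventuallyEq this
    · have : f =ᶠ[𝓝 z] fun z => resolvent T z * (Q * (1 - Q)) := by
        have hmem : {w : ℂ | |w.re| < h} ∈ 𝓝 z :=
          (isOpen_lt (continuous_abs.comp continuous_re) continuous_const).mem_nhds (by simp [h0, hh])
        filter_upwards [hmem] with w hw
        exact hfstrip w (le_of_lt hw)
      exact ((differentiableAt_resolvent (hstrip z (by simp [h0, hh.le]))).mul_const
        _).congr_of_eventuallyEq this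
    · have : f =ᶠ[𝓝 z] fun z => -N z * Q := by
        filter_upwards [(isOpen_lt continuous_const continuous_re).mem_nhds hpos] with w hw
        exact hfpos w hw
      exact ((hd z hpos.ne').neg.mul_const _).congr_of_eventuallyEq this
  have hfb : Bornology.IsBounded (Set.range f) := by
    rw [isBounded_iff_forall_norm_le]
    refine ⟨M * (‖1 - Q‖ + ‖Q‖ + ‖Q * (1 - Q)‖), ?_⟩
    rintro _ ⟨z, rfl⟩
    have h₁ := norm_nonneg (1 - Q)
    have h₂ := norm_nonneg Q
    have h₃ := norm_nonneg (Q * (1 - Q))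
    rcases lt_trichotomy z.re 0 with hneg | h0 | hpos
    · rw [hfneg z hneg]
      refine (norm_mul_le _ _).trans ?_
      gcongr
      · exact (hleft z hneg).2
      · linarith
    · rw [hfstrip z (by simp [h0, hh.le])]
      refine (norm_mul_le _ _).trans ?_
      have : z = z.im * I := by apply Complex.ext <;> simp [h0]
      gcongr
      · rw [this]
        exact haxis _
      · linarith
    · rw [hfpos z hpos]
      refine (norm_mul_le _ _).trans ?_
      rw [norm_neg]
      gcongr
      · exact (hright z hpos).2
      · linarith
  have hf0 : f 0 = 0 := by
    have h₁ : Tendsto (fun t : ℝ => resolvent T (t * I) * (Q * (1 - Q))) atTop (𝓝 0) := by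
      simpa using hlim.mul_const (Q * (1 - Q))
    refine tendsto_nhds_unique (tendsto_const_nhds (f := atTop (α := ℝ))) (h₁.congr fun t => ?_)
    rw [← hfstrip (t * I) (by simp [hh.le])]
    exact hfd.apply_eq_apply_of_bounded hfb _ _
  have h0 : |(0 : ℂ).re| ≤ h := by simp [hh.le]
  rw [hfstrip 0 h0] at hf0
  have hzero : Q * (1 - Q) = 0 := by
    ext x
    apply resolvent_injective (hstrip 0 h0)
    rw [← mul_apply_eq_comp, hf0, zero_apply, map_zero]
  rw [mul_sub, mul_one, sub_eq_zero] at hzero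
  exact hzero.symm

/-- A densely defined operator with decaying resolvent on the axis is strictly dichotomous if the
Cauchy transform of its resolvent defines bounded spectral projections. -/
theorem isStrictlyDichotomous_of_cauchyTransform {T : X →ₗ.[ℂ] X}
    (hdense : Dense (T.domain : Set X)) (haxis : imaginaryAxis ⊆ resolventSet T) {C r : ℝ}
    (hr : 0 < r) (hb : ∀ t : ℝ, ‖resolvent T (t * I)‖ ≤ C * (1 + |t|) ^ (-r)) (Q : X →L[ℂ] X)
    (hbound : ∀ h > 0, ∃ M, ∀ z : ℂ, h ≤ |z.re| →
      ‖cauchyTransform (fun t : ℝ => resolvent T (t * I)) z‖ ≤ M)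
    (hleft : ∀ z : ℂ, z.re < 0 → ∀ y : T.domain,
      cauchyTransform (fun t : ℝ => resolvent T (t * I)) z (T y - z • (y : X)) = Q y)
    (hright : ∀ z : ℂ, 0 < z.re → ∀ y : T.domain,
      cauchyTransform (fun t : ℝ => resolvent T (t * I)) z (T y - z • (y : X)) = Q y - y) :
    IsStrictlyDichotomous T := by
  set N := cauchyTransform (fun t : ℝ => resolvent T (t * I)) with hN
  have hC : 0 ≤ C := by simpa using (norm_nonneg _).trans (hb 0)
  have hbC : ∀ t : ℝ, ‖resolvent T (t * I)‖ ≤ C := fun t =>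
    (hb t).trans (mul_le_of_le_one_right hC
      (Real.rpow_le_one_of_one_le_of_nonpos (by simp) (by linarith)))
  obtain ⟨h, hh, hstrip⟩ := exists_strip haxis hbC
  obtain ⟨M₀, hM₀⟩ := hbound h hh
  have hcont := continuous_resolvent_axis haxis
  -- Multiplication by a fixed resolvent passes under the integral, where the resolvents commute.
  have hcomm : ∀ z : ℂ, z.re ≠ 0 → ∀ w ∈ imaginaryAxis,
      N z * resolvent T w = resolvent T w * N z := by
    intro z hz w hw
    have hi := integrable_inv_smul_of_decay hcont hr hb hz
    have h₁ := map_cauchyTransform (ContinuousLinearMap.mul ℂ (X →L[ℂ] X) (resolvent T w)) hi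
    have h₂ := map_cauchyTransform ((ContinuousLinearMap.mul ℂ (X →L[ℂ] X)).flip (resolvent T w)) hi
    simp only [ContinuousLinearMap.mul_apply', ContinuousLinearMap.flip_apply] at h₁ h₂
    rw [hN, h₁, h₂]
    congr 1
    ext1 t
    exact resolvent_mul_comm (haxis (axis_mem t)) (haxis hw)
  have h0 : (0 : ℂ) ∈ imaginaryAxis := by simp [imaginaryAxis]
  have hpl : ∀ z : ℂ, z.re < 0 → IsPartialResolvent T z Q (N z) := fun z hz =>
    isPartialResolvent_of_dense hdense (haxis h0) (hcomm z hz.ne 0 h0) (hleft z hz)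
  have hpr : ∀ z : ℂ, 0 < z.re → IsPartialResolvent T z (1 - Q) (-N z) := fun z hz =>
    isPartialResolvent_of_dense hdense (haxis h0)
      (by rw [neg_mul, mul_neg, hcomm z hz.ne' 0 h0]) (fun y => by
        rw [neg_apply, hright z hz y, neg_sub]
        rfl)
  have hQc : ∀ w ∈ imaginaryAxis, Q * resolvent T w = resolvent T w * Q := fun w hw =>
    (hpl (-1) (by simp)).mul_resolvent_comm (haxis hw) (hcomm _ (by simp) w hw)
  -- `M₀` serves away from the strip and the second entry inside it, where N is a resolvent times Q
  -- or -(1 - Q); the `+ 1` makes M also dominate the resolvent on the axis.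
  set M := max M₀ (2 * C * (‖Q‖ + ‖1 - Q‖ + 1)) with hM
  have hCM : ∀ a ≤ ‖Q‖ + ‖1 - Q‖ + 1, 2 * C * a ≤ M := fun a ha =>
    (mul_le_mul_of_nonneg_left ha (by positivity)).trans (le_max_right _ _)
  have hQ₁ : ‖Q‖ ≤ ‖Q‖ + ‖1 - Q‖ + 1 := by linarith [norm_nonneg (1 - Q)]
  have hQ₂ : ‖1 - Q‖ ≤ ‖Q‖ + ‖1 - Q‖ + 1 := by linarith [norm_nonneg Q]
  have hresb : ∀ (z : ℂ) (A : X →L[ℂ] X), |z.re| ≤ h → ‖A‖ ≤ ‖Q‖ + ‖1 - Q‖ + 1 →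
      ‖resolvent T z * A‖ ≤ M := fun z A hz hA =>
    (norm_mul_le _ _).trans ((mul_le_mul_of_nonneg_right (hstrip z hz).2 (norm_nonneg _)).trans
      (hCM _ hA))
  have hNM : ∀ z : ℂ, z.re ≠ 0 → ‖N z‖ ≤ M := by
    intro z hz
    rcases le_total h |z.re| with hge | hle
    · exact (hM₀ z hge).trans (le_max_left _ _)
    · rcases hz.lt_or_gt with hneg | hpos
      · rw [(hpl z hneg).eq_resolvent_mul (hstrip z hle).1]
        exact hresb z Q hle hQ₁
      · rw [← norm_neg, (hpr z hpos).eq_resolvent_mul (hstrip z hle).1]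
        exact hresb z _ hle hQ₂
  have hlim : Tendsto (fun t : ℝ => resolvent T (t * I)) atTop (𝓝 0) := by
    refine squeeze_zero_norm hb ?_
    simpa using ((tendsto_rpow_neg_atTop hr).comp
      (tendsto_atTop_add_const_left _ 1 tendsto_abs_atTop_atTop)).const_mul C
  have hidem : Q * Q = Q := isIdempotent_of_partialResolvent hh (fun z hz => (hstrip z hz).1)
    (fun z hz => differentiableAt_cauchyTransform hcont hr hb hz)
    (fun z hz => ⟨hpl z hz, hNM z hz.ne⟩) (fun z hz => ⟨hpr z hz, hNM z hz.ne'⟩)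
    (fun t => (hbC t).trans ((by linarith : C ≤ 2 * C * 1).trans
      (hCM 1 (by linarith [norm_nonneg Q, norm_nonneg (1 - Q)])))) hlim
  refine isStrictlyDichotomous_of_partialResolvent (M := M) haxis hidem (fun z hz => ?_)
    fun z hz => ?_
  · rcases hz.lt_or_eq with hlt | heq
    · exact ⟨N z, hpl z hlt, hNM z hlt.ne⟩
    · exact ⟨_, isPartialResolvent_resolvent_mul (haxis heq) (hQc z heq),
        hresb z Q (by simp [heq, hh.le]) hQ₁⟩
  · rcases hz.lt_or_eq with hlt | heq
    · exact ⟨-N z, hpr z hlt, by rw [norm_neg]; exact hNM z hlt.ne'⟩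
    · exact ⟨_, isPartialResolvent_resolvent_mul (haxis heq.symm)
        (by rw [sub_mul, mul_sub, one_mul, mul_one, hQc z heq.symm]),
        hresb z _ (by simp [← heq, hh.le]) hQ₂⟩

end Criterion

/-! ### Subordinate perturbations and transfer of resolvent decay. -/

section Perturbation

variable {X : Type*} [NormedAddCommGroup X] [NormedSpace ℂ X] {S R : X →ₗ.[ℂ] X} {p : ℝ}

theorem exists_norm_le_of_abs_le {E : Type*} [NormedAddCommGroup E] {G : ℝ → E}
    (hG : Continuous G) (t₀ : ℝ) : ∃ N, ∀ t : ℝ, |t| ≤ t₀ → ‖G t‖ ≤ N := by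
  obtain ⟨N, hN⟩ := isCompact_Icc.exists_bound_of_continuousOn (s := Set.Icc (-t₀) t₀)
    hG.continuousOn
  exact ⟨N, fun t ht => hN t (abs_le.1 ht)⟩

theorem mem_axis_iff {z : ℂ} : z ∈ imaginaryAxis ↔ ∃ t : ℝ, z = t * I := by
  constructor
  · intro h
    have h' : z.re = 0 := h
    exact ⟨z.im, by apply Complex.ext <;> simp [h']⟩
  · rintro ⟨t, rfl⟩
    exact axis_mem t

theorem add_domain_eq (h : S.domain ≤ R.domain) : (S + R).domain = S.domain := by
  rw [LinearPMap.add_domain, inf_eq_left.2 h]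

/-- Apply subordination to x = (S - z)⁻¹y with Sx = y + zx; the exponents 1 - p and p add up to 1,
so the bound is linear in ‖y‖. -/
theorem norm_perturbation_resolvent_le {c : ℝ} (hp0 : 0 ≤ p) (hp1 : p ≤ 1) (hc : 0 < c)
    (hdom : S.domain ≤ R.domain)
    (hsub : ∀ x : S.domain, ‖R ⟨x, hdom x.2⟩‖ ≤ c * (‖(x : X)‖ ^ (1 - p) * ‖S x‖ ^ p))
    {z : ℂ} (hz : z ∈ resolventSet S) (y : X) :
    ‖R ⟨resolvent S z y, hdom (resolvent_mem_domain hz y)⟩‖ ≤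
      c * (‖resolvent S z‖ ^ (1 - p) * (1 + ‖z‖ * ‖resolvent S z‖) ^ p) * ‖y‖ := by
  have h₁ := hsub ⟨_, resolvent_mem_domain hz y⟩
  refine h₁.trans ?_
  rw [map_resolvent hz]
  have h₂ : ‖resolvent S z y‖ ≤ ‖resolvent S z‖ * ‖y‖ := (resolvent S z).le_opNorm y
  have h₃ : ‖y + z • resolvent S z y‖ ≤ (1 + ‖z‖ * ‖resolvent S z‖) * ‖y‖ := by
    refine (norm_add_le _ _).trans ?_
    rw [norm_smul]
    nlinarith [norm_nonneg z]
  have h₄ : ‖y‖ ^ (1 - p) * ‖y‖ ^ p = ‖y‖ := by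
    rw [← Real.rpow_add_of_nonneg (norm_nonneg _) (by linarith) hp0, sub_add_cancel, Real.rpow_one]
  calc c * (‖resolvent S z y‖ ^ (1 - p) * ‖y + z • resolvent S z y‖ ^ p)
      ≤ c * ((‖resolvent S z‖ * ‖y‖) ^ (1 - p) *
          ((1 + ‖z‖ * ‖resolvent S z‖) * ‖y‖) ^ p) := by
        have : 0 ≤ 1 - p := by linarith
        gcongr
    _ = c * (‖resolvent S z‖ ^ (1 - p) * (1 + ‖z‖ * ‖resolvent S z‖) ^ p) *
          (‖y‖ ^ (1 - p) * ‖y‖ ^ p) := by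
        rw [Real.mul_rpow (by positivity) (by positivity),
          Real.mul_rpow (by positivity) (by positivity)]
        ring
    _ = _ := by rw [h₄]

/-- The second resolvent identity. -/
theorem resolvent_add_sub_resolvent (hdom : S.domain ≤ R.domain) {z : ℂ}
    (hz : z ∈ resolventSet S) (hz' : z ∈ resolventSet (S + R)) (y : X) :
    resolvent (S + R) z y - resolvent S z y =
      -resolvent (S + R) z (R ⟨resolvent S z y, hdom (resolvent_mem_domain hz y)⟩) := by
  have hm := resolvent_mem_domain hz y
  have h₁ := resolvent_apply_sub hz' ⟨resolvent S z y, ⟨hm, hdom hm⟩⟩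
  have h₂ : (S + R) ⟨resolvent S z y, ⟨hm, hdom hm⟩⟩ =
      S ⟨resolvent S z y, hm⟩ + R ⟨resolvent S z y, hdom hm⟩ := LinearPMap.add_apply _ _ _
  rw [h₂, map_resolvent hz] at h₁
  change resolvent (S + R) z (y + z • resolvent S z y + R ⟨resolvent S z y, hdom hm⟩ -
    z • resolvent S z y) = resolvent S z y at h₁
  rw [show y + z • resolvent S z y + R ⟨resolvent S z y, hdom hm⟩ - z • resolvent S z y =
    y + R ⟨resolvent S z y, hdom hm⟩ by abel, map_add] at h₁
  rw [sub_eq_iff_eq_add, neg_add_eq_sub, eq_sub_iff_add_eq]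
  exact h₁

theorem norm_resolvent_add_sub_le {c : ℝ} (hp0 : 0 ≤ p) (hp1 : p ≤ 1) (hc : 0 < c)
    (hdom : S.domain ≤ R.domain)
    (hsub : ∀ x : S.domain, ‖R ⟨x, hdom x.2⟩‖ ≤ c * (‖(x : X)‖ ^ (1 - p) * ‖S x‖ ^ p))
    {z : ℂ} (hz : z ∈ resolventSet S) (hz' : z ∈ resolventSet (S + R)) :
    ‖resolvent (S + R) z - resolvent S z‖ ≤ ‖resolvent (S + R) z‖ *
      (c * (‖resolvent S z‖ ^ (1 - p) * (1 + ‖z‖ * ‖resolvent S z‖) ^ p)) := by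
  refine ContinuousLinearMap.opNorm_le_bound _ (by positivity) fun y => ?_
  rw [sub_apply, resolvent_add_sub_resolvent hdom hz hz', norm_neg]
  refine ((resolvent (S + R) z).le_opNorm _).trans ?_
  rw [mul_assoc]
  gcongr
  exact norm_perturbation_resolvent_le hp0 hp1 hc hdom hsub hz y

/-- Here s is 1 + |t|, a is |t| and g is the norm of (S - it)⁻¹; the exponents combine as -β(1 - p)
+ (1 - β)p = p - β. -/
theorem subordinate_factor_le {c C₀ β s g a : ℝ} (hp0 : 0 ≤ p) (hp1 : p ≤ 1) (hc : 0 < c)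
    (hC₀ : 1 ≤ C₀) (hβ : β ≤ 1) (hs : 1 ≤ s) (hg : 0 ≤ g) (hg' : g ≤ C₀ * s ^ (-β)) (ha : 0 ≤ a)
    (has : a ≤ s) :
    c * (g ^ (1 - p) * (1 + a * g) ^ p) ≤ c * (2 * C₀) * s ^ (p - β) := by
  have hs0 : 0 < s := by linarith
  have h₁ : 1 + a * g ≤ 2 * C₀ * s ^ (1 - β) := by
    have h₂ : 1 ≤ s ^ (1 - β) := Real.one_le_rpow hs (by linarith)
    have h₃ : a * g ≤ s * (C₀ * s ^ (-β)) := by gcongr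
    have h₄ : s * (C₀ * s ^ (-β)) = C₀ * s ^ (1 - β) := by
      rw [sub_eq_add_neg, Real.rpow_add hs0, Real.rpow_one]; ring
    nlinarith
  have h₅ : g ≤ 2 * C₀ * s ^ (-β) := hg'.trans (by gcongr; linarith)
  have hq : 0 ≤ 1 - p := by linarith
  rw [mul_assoc]
  refine mul_le_mul_of_nonneg_left ?_ hc.le
  calc g ^ (1 - p) * (1 + a * g) ^ p
      ≤ (2 * C₀ * s ^ (-β)) ^ (1 - p) * (2 * C₀ * s ^ (1 - β)) ^ p := by gcongr
    _ = ((2 * C₀) ^ (1 - p) * (2 * C₀) ^ p) * (s ^ (-β * (1 - p)) * s ^ ((1 - β) * p)) := by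
        rw [Real.mul_rpow (x := 2 * C₀) (by positivity) (by positivity),
          Real.mul_rpow (x := 2 * C₀) (by positivity) (by positivity), ← Real.rpow_mul hs0.le,
          ← Real.rpow_mul hs0.le]
        ring
    _ = 2 * C₀ * s ^ (p - β) := by
        rw [← Real.rpow_add (by positivity), ← Real.rpow_add hs0, sub_add_cancel, Real.rpow_one]
        congr 2
        ring

variable [CompleteSpace X]

/-- Resolvent bounds away from the origin of the axis, in a form that includes the origin. -/
theorem exists_resolvent_le_iff {V : X →ₗ.[ℂ] X} (haxis : imaginaryAxis ⊆ resolventSet V) {γ : ℝ}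
    (hγ : 0 ≤ γ) :
    (∃ M : ℝ, ∀ z ∈ imaginaryAxis \ {0}, ‖resolvent V z‖ ≤ M / ‖z‖ ^ γ) ↔
      ∃ C : ℝ, 1 ≤ C ∧ ∀ t : ℝ, ‖resolvent V (t * I)‖ ≤ C * (1 + |t|) ^ (-γ) := by
  constructor
  · rintro ⟨M, hM⟩
    obtain ⟨N, hN⟩ := exists_norm_le_of_abs_le (continuous_resolvent_axis haxis) 1
    set K := max (max M N) 1 with hK
    have hK1 : 1 ≤ K := le_max_right _ _
    have h2 : 1 ≤ (2 : ℝ) ^ γ := Real.one_le_rpow (by norm_num) hγ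
    -- The factor 2^γ pays for 1 + |t| ≤ 2 when |t| ≤ 1 and for 1 + |t| ≤ 2|t| when |t| ≥ 1.
    refine ⟨K * 2 ^ γ, one_le_mul_of_one_le_of_one_le hK1 h2, fun t => ?_⟩
    have hpos : 0 < 1 + |t| := by positivity
    rw [Real.rpow_neg hpos.le, mul_assoc, ← div_eq_mul_inv, ← Real.div_rpow (by norm_num) hpos.le]
    rcases le_total |t| 1 with hle | hge
    · have h₁ : 1 ≤ (2 / (1 + |t|)) ^ γ :=
        Real.one_le_rpow (by rw [le_div_iff₀ hpos]; linarith) hγ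
      calc _ ≤ N := hN t hle
        _ ≤ K * 1 := by rw [mul_one]; exact (le_max_right _ _).trans (le_max_left _ _)
        _ ≤ _ := by gcongr
    · have ht : t ≠ 0 := by
        rintro rfl
        norm_num at hge
      have h₁ := hM (t * I) ⟨axis_mem t, by simp [ht]⟩
      have h₂ : ‖(t : ℂ) * I‖ = |t| := by simp
      have h₃ : 0 < |t| := by linarith
      rw [h₂] at h₁
      calc _ ≤ M / |t| ^ γ := h₁
        _ ≤ K / |t| ^ γ := by
          gcongr
          exact (le_max_left _ _).trans (le_max_left _ _)
        _ = K * (1 / |t|) ^ γ := by rw [Real.div_rpow zero_le_one h₃.le, Real.one_rpow]; ring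
        _ ≤ _ := by
          gcongr ?_ * ?_ ^ γ
          rw [div_le_div_iff₀ h₃ hpos]
          linarith
  · rintro ⟨C, hC1, hC⟩
    refine ⟨C, ?_⟩
    rintro z ⟨hz, hz0⟩
    obtain ⟨t, rfl⟩ := mem_axis_iff.1 hz
    have ht : t ≠ 0 := by
      rintro rfl
      simp at hz0
    have h₃ : 0 < |t| := abs_pos.2 ht
    have h₂ : ‖(t : ℂ) * I‖ = |t| := by simp
    rw [h₂, div_eq_mul_inv, ← Real.rpow_neg h₃.le]
    refine (hC t).trans ?_
    gcongr ?_ * ?_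
    exact Real.rpow_le_rpow_of_nonpos h₃ (by linarith) (by linarith)

/-- If the resolvent difference is eventually small relative to the perturbed resolvent, then
decay estimates on the axis carry over. -/
theorem exists_resolvent_le_of_relative {T : X →ₗ.[ℂ] X} (haxis : imaginaryAxis ⊆ resolventSet T)
    {κ : ℝ → ℝ} {t₀ : ℝ} (hκ : ∀ t : ℝ, t₀ ≤ |t| → κ t ≤ 1 / 2)
    (hdiff : ∀ t : ℝ, ‖resolvent T (t * I) - resolvent S (t * I)‖ ≤
      ‖resolvent T (t * I)‖ * κ t)
    {γ C : ℝ} (hγ : 0 ≤ γ) (hC : 1 ≤ C)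
    (hS : ∀ t : ℝ, ‖resolvent S (t * I)‖ ≤ C * (1 + |t|) ^ (-γ)) :
    ∃ C' : ℝ, 1 ≤ C' ∧ ∀ t : ℝ, ‖resolvent T (t * I)‖ ≤ C' * (1 + |t|) ^ (-γ) := by
  obtain ⟨N, hN⟩ := exists_norm_le_of_abs_le (continuous_resolvent_axis haxis) |t₀|
  have hN0 : 0 ≤ N := (norm_nonneg _).trans (hN 0 (by simp))
  -- For |t| ≥ |t₀|, half of the perturbed resolvent is absorbed, giving 2C; the second term covers
  -- the compact rest, where only continuity is used.
  refine ⟨2 * C + N * (1 + |t₀|) ^ γ, ?_, fun t => ?_⟩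
  · have : 0 ≤ N * (1 + |t₀|) ^ γ := by positivity
    linarith
  have hpos : 0 < 1 + |t| := by positivity
  have hu : 0 ≤ (1 + |t|) ^ (-γ) := by positivity
  rw [add_mul]
  rcases le_total |t₀| |t| with hge | hle
  · have h₁ : ‖resolvent T (t * I)‖ ≤
        ‖resolvent T (t * I) - resolvent S (t * I)‖ + ‖resolvent S (t * I)‖ := by
      simpa using norm_add_le (resolvent T (t * I) - resolvent S (t * I)) (resolvent S (t * I))
    have h₂ := hdiff t
    have h₃ : ‖resolvent T (t * I)‖ * κ t ≤ ‖resolvent T (t * I)‖ * (1 / 2) := by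
      gcongr
      exact hκ t ((le_abs_self _).trans hge)
    have h₄ := hS t
    have h₅ : 0 ≤ N * (1 + |t₀|) ^ γ * (1 + |t|) ^ (-γ) := by positivity
    linarith
  · have h₁ : 1 ≤ (1 + |t₀|) ^ γ * (1 + |t|) ^ (-γ) := by
      rw [Real.rpow_neg hpos.le, ← div_eq_mul_inv, one_le_div (by positivity)]
      gcongr
    have h₂ : N ≤ N * (1 + |t₀|) ^ γ * (1 + |t|) ^ (-γ) := by
      rw [mul_assoc]
      exact le_mul_of_one_le_right hN0 h₁
    have h₃ : 0 ≤ 2 * C * (1 + |t|) ^ (-γ) := by positivity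
    linarith [hN t hle]

/-- Strict dichotomy is stable under perturbations of the resolvent that are integrable along the
imaginary axis. -/
theorem isStrictlyDichotomous_of_integrable_sub {T : X →ₗ.[ℂ] X}
    (hdense : Dense (S.domain : Set X)) (hdom : T.domain = S.domain)
    (hS : IsStrictlyDichotomous S) (hT : imaginaryAxis ⊆ resolventSet T)
    {C C' r : ℝ} (hr : 0 < r)
    (hb : ∀ t : ℝ, ‖resolvent S (t * I)‖ ≤ C * (1 + |t|) ^ (-r))
    (hb' : ∀ t : ℝ, ‖resolvent T (t * I)‖ ≤ C' * (1 + |t|) ^ (-r))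
    (hi : Integrable fun t : ℝ => resolvent T (t * I) - resolvent S (t * I)) :
    IsStrictlyDichotomous T := by
  obtain ⟨Xp, Xm, hSd⟩ := hS
  obtain ⟨P, M, hP⟩ := exists_projection_cauchyTransform hdense hSd hr hb
  set K : X →L[ℂ] X := (2 * Real.pi : ℂ)⁻¹ •
    ∫ t : ℝ, (resolvent T (t * I) - resolvent S (t * I)) with hK
  have hintS : ∀ z : ℂ, z.re ≠ 0 → _ := fun z hz =>
    integrable_inv_smul_of_decay (continuous_resolvent_axis hSd.axis_subset) hr hb hz
  have hintT : ∀ z : ℂ, z.re ≠ 0 → _ := fun z hz =>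
    integrable_inv_smul_of_decay (continuous_resolvent_axis hT) hr hb' hz
  have key : ∀ z : ℂ, z.re ≠ 0 → ∀ (y : T.domain) (y' : S.domain), (y : X) = y' →
      cauchyTransform (fun t : ℝ => resolvent T (t * I)) z (T y - z • (y : X)) =
        cauchyTransform (fun t : ℝ => resolvent S (t * I)) z (S y' - z • (y' : X)) + K y := by
    intro z hz y y' hy
    have h₁ := map_cauchyTransform (ContinuousLinearMap.apply ℂ X (T y - z • (y : X)))
      (hintT z hz)
    have h₂ := map_cauchyTransform (ContinuousLinearMap.apply ℂ X (S y' - z • (y' : X)))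
      (hintS z hz)
    have i₁ := (ContinuousLinearMap.apply ℂ X (T y - z • (y : X))).integrable_comp (hintT z hz)
    have i₂ := (ContinuousLinearMap.apply ℂ X (S y' - z • (y' : X))).integrable_comp (hintS z hz)
    simp only [ContinuousLinearMap.apply_apply, smul_apply] at h₁ h₂ i₁ i₂
    have h₃ := (ContinuousLinearMap.apply ℂ X (y : X)).integral_comp_comm hi
    simp only [ContinuousLinearMap.apply_apply] at h₃
    rw [h₁, h₂, ← sub_eq_iff_eq_add', ← cauchyTransform_sub i₁ i₂, cauchyTransform, hK, smul_apply,
      ← h₃]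
    congr 1
    refine integral_congr_ae (Eventually.of_forall fun t => ?_)
    have hne := ofReal_mul_I_sub_ne_zero hz t
    -- After division by it - z the first term is y/(it - z), which is not absolutely integrable for
    -- y ≠ 0 but is the same for T and S, so only the resolvent difference remains.
    have expand : ∀ (V : X →ₗ.[ℂ] X) (_ : imaginaryAxis ⊆ resolventSet V) (x : V.domain),
        resolvent V (t * I) (V x - z • (x : X)) =
          x + ((t : ℂ) * I - z) • resolvent V (t * I) x := by
      intro V hV x
      have e₁ := resolvent_apply_sub (hV (axis_mem t)) x
      have e₂ : V x - z • (x : X) =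
          (V x - ((t : ℂ) * I) • (x : X)) + ((t : ℂ) * I - z) • (x : X) := by
        rw [sub_smul]; abel
      rw [e₂, map_add, e₁, map_smul]
    change ((t : ℂ) * I - z)⁻¹ • (resolvent T (t * I) (T y - z • (y : X)) -
      resolvent S (t * I) (S y' - z • (y' : X))) = (resolvent T (t * I) - resolvent S (t * I)) y
    rw [expand T hT y, expand S hSd.axis_subset y', ← hy, add_sub_add_left_eq_sub, ← smul_sub,
      inv_smul_smul₀ hne]
    rfl
  refine isStrictlyDichotomous_of_cauchyTransform (by rwa [hdom]) hT hr hb' (P + K)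
    (fun h hh => ⟨M + h⁻¹ * ∫ t : ℝ, ‖resolvent T (t * I) - resolvent S (t * I)‖,
      fun z hz => ?_⟩) (fun z hz y => ?_) fun z hz y => ?_
  · have hz0 : z.re ≠ 0 := abs_pos.1 (hh.trans_le hz)
    have h₁ := cauchyTransform_sub (hintT z hz0) (hintS z hz0)
    rw [eq_sub_iff_add_eq'] at h₁
    rw [← h₁]
    exact (norm_add_le _ _).trans (add_le_add (hP z hz0).1 (norm_cauchyTransform_le hi hh hz))
  · rw [key z hz.ne y ⟨y, hdom ▸ y.2⟩ rfl, (hP z hz.ne).2.1 hz]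
    rfl
  · rw [key z hz.ne' y ⟨y, hdom ▸ y.2⟩ rfl, (hP z hz.ne').2.2 hz, add_apply]
    abel

end Perturbation

end Dichotomy

/-! ### The perturbation theorem. -/

theorem corollary7p5 {X : Type*} [NormedAddCommGroup X] [NormedSpace ℂ X] [CompleteSpace X]
    (S R : X →ₗ.[ℂ] X) (β p : ℝ)
    (hSdense : Dense (S.domain : Set X))
    (hSalmost : Dichotomy.IsAlmostBisectorial S β) (hβ : 1 / 2 < β)
    (hSdich : Dichotomy.IsStrictlyDichotomous S)
    (hR : Dichotomy.IsSubordinate R S p) (hp : p < 2 * β - 1)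
    (hT : Dichotomy.imaginaryAxis ⊆ Dichotomy.resolventSet (S + R)) :
    Dichotomy.IsStrictlyDichotomous (S + R) ∧
      Dichotomy.IsAlmostBisectorial (S + R) β ∧
      (Dichotomy.IsBisectorial S → Dichotomy.IsBisectorial (S + R)) := by
  open Dichotomy in
  obtain ⟨hβ0, hβ1, -, hM⟩ := hSalmost
  obtain ⟨hp0, hp1, hdom, c, hc, hsub⟩ := hR
  have hS : imaginaryAxis ⊆ resolventSet S := by
    obtain ⟨_, _, h⟩ := hSdich
    exact h.axis_subset
  obtain ⟨C, hC1, hC⟩ := (exists_resolvent_le_iff hS hβ0.le).1 hM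
  have hdiff : ∀ t : ℝ, ‖resolvent (S + R) (t * I) - resolvent S (t * I)‖ ≤
      ‖resolvent (S + R) (t * I)‖ * (c * (2 * C) * (1 + |t|) ^ (p - β)) := fun t => by
    refine (norm_resolvent_add_sub_le hp0 hp1 hc hdom hsub (hS (axis_mem t))
      (hT (axis_mem t))).trans ?_
    refine mul_le_mul_of_nonneg_left ?_ (norm_nonneg _)
    have ht : ‖(t : ℂ) * I‖ ≤ 1 + |t| := by simp
    exact subordinate_factor_le hp0 hp1 hc hC1 hβ1.le (by simp) (norm_nonneg _) (hC t)
      (norm_nonneg _) ht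
  -- The exponent is negative: p < 2β - 1 < β because β < 1.
  have hlim : Tendsto (fun s : ℝ => c * (2 * C) * (1 + s) ^ (p - β)) atTop (𝓝 0) := by
    have := ((tendsto_rpow_neg_atTop (by linarith : 0 < β - p)).comp
      (tendsto_atTop_add_const_left _ 1 tendsto_id)).const_mul (c * (2 * C))
    simpa [Function.comp_def] using this
  obtain ⟨t₀, ht₀⟩ := eventually_atTop.1
    (hlim.eventually_le_const (by norm_num : (0 : ℝ) < 1 / 2))
  -- Stated for every γ because it is used with γ = β and, for the bisectorial claim, with γ = 1.
  have htransfer : ∀ γ : ℝ, 0 ≤ γ →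
      (∃ M : ℝ, ∀ z ∈ imaginaryAxis \ {0}, ‖resolvent S z‖ ≤ M / ‖z‖ ^ γ) →
      ∃ M : ℝ, ∀ z ∈ imaginaryAxis \ {0}, ‖resolvent (S + R) z‖ ≤ M / ‖z‖ ^ γ := by
    intro γ hγ h
    obtain ⟨C₁, hC₁, hb⟩ := (exists_resolvent_le_iff hS hγ).1 h
    exact (exists_resolvent_le_iff hT hγ).2
      (exists_resolvent_le_of_relative hT (fun t ht => ht₀ _ ht) hdiff hγ hC₁ hb)
  have hTβ := htransfer β hβ0.le hM
  obtain ⟨C', hC'1, hC'⟩ := (exists_resolvent_le_iff hT hβ0.le).1 hTβ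
  have hsubset : imaginaryAxis \ {0} ⊆ resolventSet (S + R) := Set.sdiff_subset.trans hT
  refine ⟨?_, ⟨hβ0, hβ1, hsubset, hTβ⟩, fun hbis => ⟨hsubset, ?_⟩⟩
  · refine isStrictlyDichotomous_of_integrable_sub hSdense (add_domain_eq hdom) hSdich hT hβ0 hC hC'
      (((integrable_one_add_abs_rpow (r := 2 * β - p) (by linarith)).const_mul
        (C' * (c * (2 * C)))).mono' ((continuous_resolvent_axis hT).sub
          (continuous_resolvent_axis hS)).aestronglyMeasurable
        (Eventually.of_forall fun t => (hdiff t).trans ?_))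
    have hpos : 0 < 1 + |t| := by positivity
    calc _ ≤ (C' * (1 + |t|) ^ (-β)) * (c * (2 * C) * (1 + |t|) ^ (p - β)) := by
          gcongr
          exact hC' t
      _ = C' * (c * (2 * C)) * ((1 + |t|) ^ (-β) * (1 + |t|) ^ (p - β)) := by ring
      _ = _ := by
          rw [← Real.rpow_add hpos]
          congr 2
          ring
  · simpa only [Real.rpow_one] using htransfer 1 zero_le_one
      (by simpa only [Real.rpow_one] using hbis.2)
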